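/- Write $D_s=\{\xi\in\mathbb C:|\xi|<s\}$ and $D=D_1$. For a closed disk $E=\overline{D_s}$ let $H(E)$ be the set of functions analytic in a neighbourhood of $E$, and let $O(E)$ be the set of $f\in H(E)$ that are univalent (analytic and injective) in a neighbourhood of $E$ with $f(0)=0$ and $f'(0)>0$. For $b\ge 0$, $f\in C^1([0,b],H(E))$ means that there are an open set $U\supseteq E$ on which all $f(\cdot,t)$, $0\le t\le b$, are analytic and functions $f_t(\cdot,t)$ analytic on $U$ such that $f_t$ is the derivative of $t\mapsto f(\cdot,t)$ on $[0,b]$ (one-sided at the end points) and $t\mapsto f_t(\cdot,t)$ is continuous, both with respect to uniform convergence on $U$. Let $I=[0,b]$ or $I=[0,b)$ with $b>0$. A strong solution on $I$ of the Polubarinova–Galin equation (injection case) is a function $f(\xi,t)$ such that $f(\cdot,t)\in O(\overline D)$ for every $t\in I$, $f$ is continuously differentiable in $t\in I$ (that is, $f\in C^1([0,T],H(\overline D))$ for every $T\in I$), and $$\operatorname{Re}\left[f_t(\xi,t)\,\overline{\xi f'(\xi,t)}\right]=1\qquad(|\xi|=1,\ t\in I),$$ where $f'=\partial f/\partial\xi$.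 **Theorem.** (a) Let $\rho_0>r>1$ and let $f_0$ be analytic in a neighbourhood of $\overline{D_{\rho_0}}$ and injective on $\overline{D_r}$, with $f_0(0)=0$ and $f_0'(0)>0$. Then for every $r'$ with $1<r'<r$ there are $b>0$ and a strong solution $f$ on $[0,b]$ with $f(\cdot,0)=f_0$ on $\overline{D_{r'}}$, $f\in C^1([0,b],H(\overline{D_{r'}}))$, and $f(\cdot,t)\in O(\overline{D_{r'}})$ for all $t\in[0,b]$. (b) Consequently, for every $f_0\in O(\overline D)$ there are $b>0$ and a strong solution $f$ on $[0,b)$ with $f(\cdot,0)=f_0$ on $\overline D$. -/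

import Mathlib

namespace HeleShaw

/-- The closed disk of radius `r` centred at the origin. -/
def closedDisk (r : ℝ) : Set ℂ := Metric.closedBall (0 : ℂ) r

/-- Functions analytic on `E`, i.e. in a neighbourhood of every point of `E`. -/
def H (E : Set ℂ) : Set (ℂ → ℂ) := {f | AnalyticOnNhd ℂ f E}

/-- The normalization `f(0) = 0` and `f'(0) > 0` (a positive real number). -/
def Normalized (f : ℂ → ℂ) : Prop :=
  f 0 = 0 ∧ (deriv f 0).im = 0 ∧ 0 < (deriv f 0).re

/-- Normalized functions that are analytic and univalent in a neighbourhood of `E`. -/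
def O (E : Set ℂ) : Set (ℂ → ℂ) :=
  {f | (∃ U : Set ℂ, IsOpen U ∧ E ⊆ U ∧ AnalyticOnNhd ℂ f U ∧ Set.InjOn f U) ∧ Normalized f}

/-- `f ∈ C¹([0,T], H(E))` for compact `E`: on one common open neighbourhood `U` of `E` all the
`f t` are analytic, and `t ↦ f t` has a time derivative `g` on `[0,T]` (one-sided at the end
points) that is again analytic on `U` and continuous in `t`; both limits are uniform on `U`. -/
def IsC1 (T : ℝ) (E : Set ℂ) (f : ℝ → ℂ → ℂ) : Prop :=
  ∃ U : Set ℂ, IsOpen U ∧ E ⊆ U ∧ ∃ g : ℝ → ℂ → ℂ, ∀ t ∈ Set.Icc 0 T,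
    AnalyticOnNhd ℂ (f t) U ∧ AnalyticOnNhd ℂ (g t) U ∧
    TendstoUniformlyOn (fun (s : ℝ) (z : ℂ) => (f s z - f t z) / ((s - t : ℝ) : ℂ)) (g t)
      (nhdsWithin t (Set.Icc 0 T \ {t})) U ∧
    TendstoUniformlyOn g (g t) (nhdsWithin t (Set.Icc 0 T)) U

/-- `f` is a strong solution of the Polubarinova–Galin equation (injection case) on the time
interval `I`, which is to be `[0,b)` or `[0,b]`. -/
structure IsStrongSolution (I : Set ℝ) (f : ℝ → ℂ → ℂ) : Prop where
  univalent : ∀ t ∈ I, f t ∈ O (closedDisk 1)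
  contDiff : ∀ T ∈ I, IsC1 T (closedDisk 1) f
  equation : ∀ t ∈ I, ∀ ξ : ℂ, ‖ξ‖ = 1 →
    (derivWithin (fun s : ℝ => f s ξ) I t *
      (starRingEnd ℂ) (deriv (f t) ξ * ξ)).re = 1

end HeleShaw

/-!
Put `p = 1 / f'` and let `h` be analytic in the disk with `Re h = |p|²` on the unit circle and
`h 0` real. The Polubarinova–Galin equation says `f_t = z h / p`, and differentiating in `z` gives
`p_t = z (h p' - h' p) - h p`. On the circle `|p|² = p p̄`, so the Taylor coefficients of `h` are
correlations of those of `p`: this is an infinite cubic system for the Taylor coefficients of `p`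
in which the `n`-th equation loses one factor `n`.

That loss is absorbed by letting the radius shrink. With the `n`-th coefficient weighted by
`s(t) ^ n`, `s(t) = s₀ exp (-L t)`, the Duhamel integral carries the damping `exp (-L n (t - τ))`,
whose time integral is `O(1 / n)` with a small constant when `L` is large. The system is then a
fixed point problem for a contraction in `ℓ¹(ℕ, C([0, b]))`.

Finally `f` is recovered by integrating `z h / p` in time. It stays univalent because `f₀` is
reverse Lipschitz on compact subsets of the disk where it is injective, and `1 / p` stays close to
`f₀'`.
-/

namespace HeleShaw

open Set Filter Topology
open scoped lp
open Finset.HasAntidiagonal (antidiagonal)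

section Univalent

variable {f : ℂ → ℂ} {B U : Set ℂ} {a : ℂ}

theorem nhds_le_map_nhds_of_injOn (hf : AnalyticAt ℂ f a) (hU : U ∈ 𝓝 a) (hinj : InjOn f U) :
    𝓝 (f a) ≤ map f (𝓝 a) := by
  refine hf.eventually_constant_or_nhds_le_map_nhds.resolve_left fun hconst => ?_
  obtain ⟨z, ⟨hza, hzU⟩, hne⟩ :=
    (infinite_of_mem_nhds a (inter_mem hconst hU)).nontrivial.exists_ne a
  exact hne (hinj hzU (mem_of_mem_nhds hU) hza)

theorem image_mem_nhds_of_injOn (hf : AnalyticAt ℂ f a) (hU : U ∈ 𝓝 a) (hinj : InjOn f U) :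
    f '' U ∈ 𝓝 (f a) :=
  nhds_le_map_nhds_of_injOn hf hU hinj (image_mem_map hU)

theorem continuousAt_invFunOn (hf : AnalyticAt ℂ f a) (hU : U ∈ 𝓝 a) (hinj : InjOn f U) :
    ContinuousAt (Function.invFunOn f U) (f a) := by
  have hleft : Function.invFunOn f U ∘ f =ᶠ[𝓝 a] id := by
    filter_upwards [hU] with z hz using hinj.leftInvOn_invFunOn hz
  rw [ContinuousAt, hinj.leftInvOn_invFunOn (mem_of_mem_nhds hU)]
  exact (tendsto_map'_iff.2 (tendsto_id.congr' hleft.symm)).mono_left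
    (nhds_le_map_nhds_of_injOn hf hU hinj)

theorem differentiableAt_invFunOn_of_deriv_ne_zero (hf : AnalyticAt ℂ f a) (hU : U ∈ 𝓝 a)
    (hinj : InjOn f U) (hderiv : deriv f a ≠ 0) :
    DifferentiableAt ℂ (Function.invFunOn f U) (f a) := by
  refine (HasDerivAt.of_local_left_inverse (f := f) (f' := deriv f a)
    (continuousAt_invFunOn hf hU hinj) ?_ hderiv ?_).differentiableAt
  · rw [hinj.leftInvOn_invFunOn (mem_of_mem_nhds hU)]
    exact hf.differentiableAt.hasDerivAt
  · filter_upwards [image_mem_nhds_of_injOn hf hU hinj] with y hy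
    exact Function.invFunOn_eq hy

theorem eventually_deriv_ne_zero_of_injOn (hf : AnalyticAt ℂ f a) (hU : U ∈ 𝓝 a)
    (hinj : InjOn f U) : ∀ᶠ z in 𝓝[≠] a, deriv f z ≠ 0 := by
  refine hf.deriv.eventually_eq_zero_or_eventually_ne_zero.resolve_left fun hzero => ?_
  obtain ⟨ε, hε, hball⟩ :=
    Metric.mem_nhds_iff.1 (inter_mem (hzero.and hf.eventually_analyticAt) hU)
  obtain ⟨z, hz, hne⟩ :=
    (infinite_of_mem_nhds a (Metric.ball_mem_nhds a hε)).nontrivial.exists_ne a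
  refine hne (hinj (hball hz).2 (mem_of_mem_nhds hU) ?_)
  exact Metric.isOpen_ball.is_const_of_deriv_eq_zero (convex_ball a ε).isPreconnected
    (fun w hw => (hball hw).1.2.differentiableAt.differentiableWithinAt)
    (fun w hw => (hball hw).1.1) hz (Metric.mem_ball_self hε)

/- Critical points are isolated, so the continuous inverse is differentiable off `f a`, and the
singularity at `f a` is removable. -/
theorem differentiableAt_invFunOn (hf : AnalyticAt ℂ f a) (hU : U ∈ 𝓝 a) (hinj : InjOn f U) :
    DifferentiableAt ℂ (Function.invFunOn f U) (f a) := by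
  have hregular : ∀ᶠ z in 𝓝 a, AnalyticAt ℂ f z ∧ U ∈ 𝓝 z ∧ (z ≠ a → deriv f z ≠ 0) :=
    hf.eventually_analyticAt.and ((eventually_mem_nhds_iff.2 hU).and
      (eventually_nhdsWithin_iff.1 (eventually_deriv_ne_zero_of_injOn hf hU hinj)))
  obtain ⟨V, hVregular, hVopen, haV⟩ := mem_nhds_iff.1 hregular
  have hVU : V ⊆ U := fun z hz => mem_of_mem_nhds (hVregular hz).2.1
  have hnhds : f '' V ∈ 𝓝 (f a) :=
    image_mem_nhds_of_injOn hf (hVopen.mem_nhds haV) (hinj.mono hVU)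
  refine ((Complex.differentiableOn_compl_singleton_and_continuousAt_iff hnhds).1
    ⟨?_, continuousAt_invFunOn hf hU hinj⟩).differentiableAt hnhds
  rintro _ ⟨⟨z, hz, rfl⟩, hza⟩
  obtain ⟨hfz, hUz, hderiv⟩ := hVregular hz
  exact (differentiableAt_invFunOn_of_deriv_ne_zero hfz hUz hinj
    (hderiv fun h => hza (h ▸ rfl))).differentiableWithinAt

theorem deriv_ne_zero_of_injOn (hf : AnalyticAt ℂ f a) (hU : U ∈ 𝓝 a) (hinj : InjOn f U) :
    deriv f a ≠ 0 := by
  intro hzero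
  have hcomp : HasDerivAt (Function.invFunOn f U ∘ f)
      (deriv (Function.invFunOn f U) (f a) * deriv f a) a :=
    (differentiableAt_invFunOn hf hU hinj).hasDerivAt.comp a hf.differentiableAt.hasDerivAt
  have hid : HasDerivAt (Function.invFunOn f U ∘ f) 1 a :=
    (hasDerivAt_id a).congr_of_eventuallyEq <| by
      filter_upwards [hU] with z hz using hinj.leftInvOn_invFunOn hz
  simpa [hzero] using hcomp.unique hid

theorem eventually_mul_norm_sub_le_of_deriv_ne_zero (hf : AnalyticAt ℂ f a)
    (hderiv : deriv f a ≠ 0) :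
    ∃ c > 0, ∀ᶠ q : ℂ × ℂ in 𝓝 (a, a), c * ‖q.1 - q.2‖ ≤ ‖f q.1 - f q.2‖ := by
  have hpos : 0 < ‖deriv f a‖ := norm_pos_iff.2 hderiv
  refine ⟨‖deriv f a‖ / 2, by positivity, ?_⟩
  filter_upwards [hf.hasStrictDerivAt.isLittleO.def (half_pos hpos)] with q hq
  have htriangle : ‖(q.1 - q.2) • deriv f a‖ ≤
      ‖f q.1 - f q.2‖ + ‖f q.1 - f q.2 - (q.1 - q.2) • deriv f a‖ := by
    simpa using norm_sub_le (f q.1 - f q.2) (f q.1 - f q.2 - (q.1 - q.2) • deriv f a)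
  rw [norm_smul] at htriangle
  simp only [ContinuousLinearMap.toSpanSingleton_apply] at hq
  linarith

theorem eventually_mul_norm_sub_le_of_ne {X Y : Type*} [NormedAddCommGroup X]
    [NormedAddCommGroup Y] {f : X → Y} {a b : X} (ha : ContinuousAt f a) (hb : ContinuousAt f b)
    (hne : f a ≠ f b) :
    ∃ c > 0, ∀ᶠ q : X × X in 𝓝 (a, b), c * ‖q.1 - q.2‖ ≤ ‖f q.1 - f q.2‖ := by
  have hpos : 0 < ‖f a - f b‖ := norm_pos_iff.2 (sub_ne_zero.2 hne)
  have hpos' : 0 < ‖a - b‖ := norm_pos_iff.2 (sub_ne_zero.2 fun h => hne (h ▸ rfl))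
  refine ⟨‖f a - f b‖ / (2 * ‖a - b‖), by positivity, ?_⟩
  have hleft : ContinuousAt
      (fun q : X × X => ‖f a - f b‖ / (2 * ‖a - b‖) * ‖q.1 - q.2‖) (a, b) := by fun_prop
  have hright : ContinuousAt (fun q : X × X => ‖f q.1 - f q.2‖) (a, b) :=
    ((ha.comp' continuousAt_fst).sub (hb.comp' continuousAt_snd)).norm
  have hlt : ‖f a - f b‖ / (2 * ‖a - b‖) * ‖a - b‖ < ‖f a - f b‖ := by
    field_simp
    linarith
  filter_upwards [hleft.eventually_lt hright hlt] with q hq using hq.le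

theorem exists_mul_norm_sub_le_of_injOn {K : Set ℂ} (hB : IsOpen B) (hf : AnalyticOnNhd ℂ f B)
    (hinj : InjOn f B) (hK : IsCompact K) (hKB : K ⊆ B) :
    ∃ c > 0, ∀ z ∈ K, ∀ w ∈ K, c * ‖z - w‖ ≤ ‖f z - f w‖ := by
  suffices h : ∃ c > 0, ∀ q ∈ K ×ˢ K, c * ‖q.1 - q.2‖ ≤ ‖f q.1 - f q.2‖ by
    obtain ⟨c, hc, h⟩ := h
    exact ⟨c, hc, fun z hz w hw => h (z, w) ⟨hz, hw⟩⟩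
  refine (hK.prod hK).induction_on
    (p := fun S => ∃ c > 0, ∀ q ∈ S, c * ‖q.1 - q.2‖ ≤ ‖f q.1 - f q.2‖) ?_ ?_ ?_ ?_
  · exact ⟨1, one_pos, by simp⟩
  · rintro s t hst ⟨c, hc, h⟩
    exact ⟨c, hc, fun q hq => h q (hst hq)⟩
  · rintro s t ⟨c, hc, h⟩ ⟨d, hd, h'⟩
    refine ⟨min c d, lt_min hc hd, ?_⟩
    rintro q (hq | hq)
    · exact (mul_le_mul_of_nonneg_right (min_le_left _ _) (norm_nonneg _)).trans (h q hq)
    · exact (mul_le_mul_of_nonneg_right (min_le_right _ _) (norm_nonneg _)).trans (h' q hq)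
  · rintro ⟨a, b⟩ ⟨ha, hb⟩
    have hlocal : ∃ c > 0, ∀ᶠ q : ℂ × ℂ in 𝓝 (a, b), c * ‖q.1 - q.2‖ ≤ ‖f q.1 - f q.2‖ := by
      rcases eq_or_ne a b with rfl | hab
      · exact eventually_mul_norm_sub_le_of_deriv_ne_zero (hf a (hKB ha))
          (deriv_ne_zero_of_injOn (hf a (hKB ha)) (hB.mem_nhds (hKB ha)) hinj)
      · exact eventually_mul_norm_sub_le_of_ne (hf a (hKB ha)).continuousAt
          (hf b (hKB hb)).continuousAt (hinj.ne (hKB ha) (hKB hb) hab)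
    obtain ⟨c, hc, h⟩ := hlocal
    exact ⟨_, nhdsWithin_le_nhds h, c, hc, fun q hq => hq⟩

theorem injOn_of_norm_deriv_sub_le {f f₀ f' f₀' : ℂ → ℂ} {V : Set ℂ} {c η : ℝ}
    (hV : Convex ℝ V) (hc : ∀ z ∈ V, ∀ w ∈ V, c * ‖z - w‖ ≤ ‖f₀ z - f₀ w‖)
    (hf₀ : ∀ z ∈ V, HasDerivAt f₀ (f₀' z) z) (hf : ∀ z ∈ V, HasDerivAt f (f' z) z)
    (hη : ∀ z ∈ V, ‖f' z - f₀' z‖ ≤ η) (hηc : η < c) : InjOn f V := by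
  intro z hz w hw hzw
  by_contra hne
  have hmean : ‖(f z - f₀ z) - (f w - f₀ w)‖ ≤ η * ‖z - w‖ :=
    hV.norm_image_sub_le_of_norm_hasDerivWithin_le
      (fun x hx => ((hf x hx).sub (hf₀ x hx)).hasDerivWithinAt) hη hw hz
  have hdiff : (f z - f₀ z) - (f w - f₀ w) = -(f₀ z - f₀ w) := by rw [hzw]; ring
  rw [hdiff, norm_neg] at hmean
  have hle : c * ‖z - w‖ ≤ η * ‖z - w‖ := (hc z hz w hw).trans hmean
  exact hηc.not_ge (le_of_mul_le_mul_right hle (norm_pos_iff.2 (sub_ne_zero.2 hne)))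

end Univalent

section CubicFixedPoint

variable {E : Type*} [NormedAddCommGroup E] {T : E →+ E →+ E →+ E} {K R : ℝ}

theorem norm_cubic_le (hT : ∀ u v w, ‖T u v w‖ ≤ K * (‖u‖ * ‖v‖ * ‖w‖)) (hK : 0 ≤ K) {u : E}
    (hu : ‖u‖ ≤ R) : ‖T u u u‖ ≤ K * R ^ 3 :=
  calc ‖T u u u‖ ≤ K * (‖u‖ * ‖u‖ * ‖u‖) := hT u u u
    _ = K * ‖u‖ ^ 3 := by ring
    _ ≤ K * R ^ 3 := by gcongr

theorem norm_cubic_sub_le (hT : ∀ u v w, ‖T u v w‖ ≤ K * (‖u‖ * ‖v‖ * ‖w‖)) (hK : 0 ≤ K)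
    {u v : E} (hu : ‖u‖ ≤ R) (hv : ‖v‖ ≤ R) :
    ‖T u u u - T v v v‖ ≤ 3 * K * R ^ 2 * ‖u - v‖ := by
  have hR : 0 ≤ R := (norm_nonneg u).trans hu
  have htelescope : T u u u - T v v v = T (u - v) u u + T v (u - v) u + T v v (u - v) := by
    simp only [map_sub, AddMonoidHom.sub_apply]
    abel
  calc ‖T u u u - T v v v‖
      ≤ ‖T (u - v) u u‖ + ‖T v (u - v) u‖ + ‖T v v (u - v)‖ := htelescope ▸ norm_add₃_le
    _ ≤ K * (‖u - v‖ * ‖u‖ * ‖u‖) + K * (‖v‖ * ‖u - v‖ * ‖u‖) + K * (‖v‖ * ‖v‖ * ‖u - v‖) := by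
        gcongr <;> apply hT
    _ ≤ K * (‖u - v‖ * R * R) + K * (R * ‖u - v‖ * R) + K * (R * R * ‖u - v‖) := by gcongr
    _ = 3 * K * R ^ 2 * ‖u - v‖ := by ring

theorem exists_cubic_fixedPoint [CompleteSpace E]
    (hT : ∀ u v w, ‖T u v w‖ ≤ K * (‖u‖ * ‖v‖ * ‖w‖)) (hK : 0 ≤ K) {u₀ : E} {δ : ℝ} (hδ : 0 ≤ δ)
    (hR : ‖u₀‖ + δ ≤ R) (hself : K * R ^ 3 ≤ δ) (hcontr : 3 * K * R ^ 2 < 1) :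
    ∃ u, ‖u - u₀‖ ≤ δ ∧ u = u₀ + T u u u := by
  let Φ : E → E := fun u => u₀ + T u u u
  have hnorm : ∀ u ∈ Metric.closedBall u₀ δ, ‖u‖ ≤ R := fun u hu =>
    (norm_le_of_mem_closedBall hu).trans hR
  have hmaps : MapsTo Φ (Metric.closedBall u₀ δ) (Metric.closedBall u₀ δ) := fun u hu => by
    simpa only [mem_closedBall_iff_norm, Φ, add_sub_cancel_left] using
      (norm_cubic_le hT hK (hnorm u hu)).trans hself
  have hcontracting : ContractingWith (3 * K * R ^ 2).toNNReal (hmaps.restrict Φ _ _) := by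
    refine ⟨Real.toNNReal_lt_one.2 hcontr, LipschitzWith.of_dist_le_mul ?_⟩
    rintro ⟨u, hu⟩ ⟨v, hv⟩
    rw [Real.coe_toNNReal _ (by positivity)]
    simpa only [Subtype.dist_eq, MapsTo.val_restrict_apply, dist_eq_norm, Φ,
      add_sub_add_left_eq_sub] using norm_cubic_sub_le hT hK (hnorm u hu) (hnorm v hv)
  obtain ⟨u, hu, hfixed, -⟩ := ContractingWith.exists_fixedPoint'
    Metric.isClosed_closedBall.isComplete hmaps hcontracting (Metric.mem_closedBall_self hδ)
    (edist_ne_top _ _)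
  exact ⟨u, mem_closedBall_iff_norm.1 hu, hfixed.symm⟩

end CubicFixedPoint

section CorrelationSums

variable {a b : ℕ → ℝ}

theorem summable_add_mul (ha : Summable a) (hb : Summable b) (ha0 : ∀ n, 0 ≤ a n)
    (hb0 : ∀ n, 0 ≤ b n) : Summable fun x : ℕ × ℕ => a (x.1 + x.2) * b x.2 :=
  (ha.mul_of_nonneg hb ha0 hb0).comp_injective
    (i := fun x : ℕ × ℕ => (x.1 + x.2, x.2)) fun x y h => by
      simp only [Prod.mk.injEq] at h
      ext <;> omega

theorem tsum_add_mul_le (ha : Summable a) (hb : Summable b) (ha0 : ∀ n, 0 ≤ a n)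
    (hb0 : ∀ n, 0 ≤ b n) :
    ∑' j, ∑' m, a (j + m) * b m ≤ (∑' n, a n) * ∑' n, b n := by
  have hab := ha.mul_of_nonneg hb ha0 hb0
  have hsum := summable_add_mul ha hb ha0 hb0
  rw [ha.tsum_mul_tsum hb hab, ← hsum.tsum_prod]
  exact hsum.tsum_le_tsum_of_inj (fun x : ℕ × ℕ => (x.1 + x.2, x.2))
    (fun x y h => by simp only [Prod.mk.injEq] at h; ext <;> omega)
    (fun _ _ => mul_nonneg (ha0 _) (hb0 _)) (fun _ => le_rfl) hab

end CorrelationSums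

section Herglotz

variable {E : Type*} [NormedRing E] [StarAddMonoid E] {ρ u v : ℕ → E}

/-- With `ρ = 1`, the Taylor coefficients of the analytic function whose real part on the unit
circle is that of `(∑ uₙ zⁿ) * conj (∑ vₙ zⁿ)`. The weight `ρ` accounts for sequences `u`, `v` that
have been rescaled by powers of a radius. -/
noncomputable def herglotzCoeff (ρ u v : ℕ → E) (j : ℕ) : E :=
  (if j = 0 then 1 else 2 : ℕ) • ∑' m, u (j + m) * star (v m) * ρ m

variable [NormedStarGroup E]

theorem norm_mul_star_mul_le {x y w : E} (hw : ‖w‖ ≤ 1) : ‖x * star y * w‖ ≤ ‖x‖ * ‖y‖ :=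
  calc ‖x * star y * w‖ ≤ ‖x‖ * ‖star y‖ * ‖w‖ := norm_mul₃_le
    _ ≤ ‖x‖ * ‖star y‖ * 1 := by gcongr
    _ = ‖x‖ * ‖y‖ := by rw [mul_one, norm_star]

theorem norm_herglotzCoeff_le (hρ : ∀ m, ‖ρ m‖ ≤ 1) {j : ℕ}
    (huv : Summable fun m => ‖u (j + m)‖ * ‖v m‖) :
    ‖herglotzCoeff ρ u v j‖ ≤ 2 * ∑' m, ‖u (j + m)‖ * ‖v m‖ := by
  have hfactor : (if j = 0 then 1 else 2 : ℕ) ≤ 2 := by split_ifs <;> norm_num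
  calc ‖herglotzCoeff ρ u v j‖
      ≤ (if j = 0 then 1 else 2 : ℕ) * ‖∑' m, u (j + m) * star (v m) * ρ m‖ := norm_nsmul_le
    _ ≤ 2 * ∑' m, ‖u (j + m)‖ * ‖v m‖ := by
        gcongr
        · exact_mod_cast hfactor
        · exact tsum_of_norm_bounded huv.hasSum fun m => norm_mul_star_mul_le (hρ m)

theorem summable_norm_herglotzCoeff (hρ : ∀ m, ‖ρ m‖ ≤ 1) (hu : Summable fun n => ‖u n‖)
    (hv : Summable fun n => ‖v n‖) : Summable fun j => ‖herglotzCoeff ρ u v j‖ := by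
  have hsum := summable_add_mul hu hv (fun _ => norm_nonneg _) (fun _ => norm_nonneg _)
  exact .of_nonneg_of_le (fun _ => norm_nonneg _)
    (fun j => norm_herglotzCoeff_le hρ (hsum.prod_factor j)) (hsum.prod.mul_left 2)

theorem tsum_norm_herglotzCoeff_le (hρ : ∀ m, ‖ρ m‖ ≤ 1) (hu : Summable fun n => ‖u n‖)
    (hv : Summable fun n => ‖v n‖) :
    ∑' j, ‖herglotzCoeff ρ u v j‖ ≤ 2 * ((∑' n, ‖u n‖) * ∑' n, ‖v n‖) := by
  have hsum := summable_add_mul hu hv (fun _ => norm_nonneg _) (fun _ => norm_nonneg _)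
  calc ∑' j, ‖herglotzCoeff ρ u v j‖ ≤ ∑' j, 2 * ∑' m, ‖u (j + m)‖ * ‖v m‖ :=
        (summable_norm_herglotzCoeff hρ hu hv).tsum_le_tsum
          (fun j => norm_herglotzCoeff_le hρ (hsum.prod_factor j)) (hsum.prod.mul_left 2)
    _ ≤ 2 * ((∑' n, ‖u n‖) * ∑' n, ‖v n‖) := by
        rw [tsum_mul_left]
        gcongr
        exact tsum_add_mul_le hu hv (fun _ => norm_nonneg _) (fun _ => norm_nonneg _)

variable [CompleteSpace E]

theorem summable_mul_star_mul (hρ : ∀ m, ‖ρ m‖ ≤ 1) (hu : Summable fun n => ‖u n‖)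
    (hv : Summable fun n => ‖v n‖) (j : ℕ) :
    Summable fun m => u (j + m) * star (v m) * ρ m :=
  .of_norm_bounded
    ((summable_add_mul hu hv (fun _ => norm_nonneg _) (fun _ => norm_nonneg _)).prod_factor j)
    fun m => norm_mul_star_mul_le (hρ m)

theorem herglotzCoeff_add_left {u' : ℕ → E} (hρ : ∀ m, ‖ρ m‖ ≤ 1)
    (hu : Summable fun n => ‖u n‖) (hu' : Summable fun n => ‖u' n‖)
    (hv : Summable fun n => ‖v n‖) :
    herglotzCoeff ρ (u + u') v = herglotzCoeff ρ u v + herglotzCoeff ρ u' v := by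
  ext j
  simp only [herglotzCoeff, Pi.add_apply, add_mul, ← smul_add,
    (summable_mul_star_mul hρ hu hv j).tsum_add (summable_mul_star_mul hρ hu' hv j)]

theorem herglotzCoeff_add_right {v' : ℕ → E} (hρ : ∀ m, ‖ρ m‖ ≤ 1)
    (hu : Summable fun n => ‖u n‖) (hv : Summable fun n => ‖v n‖)
    (hv' : Summable fun n => ‖v' n‖) :
    herglotzCoeff ρ u (v + v') = herglotzCoeff ρ u v + herglotzCoeff ρ u v' := by
  ext j
  simp only [herglotzCoeff, Pi.add_apply, star_add, mul_add, add_mul, ← smul_add,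
    (summable_mul_star_mul hρ hu hv j).tsum_add (summable_mul_star_mul hρ hu hv' j)]

end Herglotz

section Transport

/-- The Taylor coefficients of `h * (z * u') - z * h' * u - h * u`, for `h = ∑ hₙ zⁿ` and
`u = ∑ uₙ zⁿ`. -/
def transportCoeff {E : Type*} [Ring E] (h u : ℕ → E) (n : ℕ) : E :=
  ∑ x ∈ antidiagonal n, ((x.2 : ℤ) - x.1 - 1) • (h x.1 * u x.2)

theorem transportCoeff_add_left {E : Type*} [Ring E] (h h' u : ℕ → E) :
    transportCoeff (h + h') u = transportCoeff h u + transportCoeff h' u := by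
  ext n
  simp only [transportCoeff, Pi.add_apply, add_mul, smul_add, Finset.sum_add_distrib]

theorem transportCoeff_add_right {E : Type*} [Ring E] (h u u' : ℕ → E) :
    transportCoeff h (u + u') = transportCoeff h u + transportCoeff h u' := by
  ext n
  simp only [transportCoeff, Pi.add_apply, mul_add, smul_add, Finset.sum_add_distrib]

variable {E : Type*} [NormedRing E]

theorem norm_transportCoeff_le (h u : ℕ → E) (n : ℕ) :
    ‖transportCoeff h u n‖ ≤ (n + 1) * ∑ x ∈ antidiagonal n, ‖h x.1‖ * ‖u x.2‖ := by
  rw [transportCoeff, Finset.mul_sum]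
  refine norm_sum_le_of_le _ fun x hx => ?_
  have habs : |(x.2 : ℤ) - x.1 - 1| ≤ n + 1 := by
    rw [Finset.HasAntidiagonal.mem_antidiagonal] at hx
    exact abs_le.2 ⟨by omega, by omega⟩
  have hscalar : ‖((x.2 : ℤ) - x.1 - 1)‖ ≤ n + 1 := by
    rw [Int.norm_eq_abs]
    exact_mod_cast habs
  calc ‖((x.2 : ℤ) - x.1 - 1) • (h x.1 * u x.2)‖
      ≤ ‖((x.2 : ℤ) - x.1 - 1)‖ * ‖h x.1 * u x.2‖ := norm_zsmul_le _ _
    _ ≤ (n + 1) * (‖h x.1‖ * ‖u x.2‖) := by gcongr; exact norm_mul_le _ _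

variable {J : ℕ → E →+ E} {ε : ℝ} {h u : ℕ → E}

theorem norm_smoothed_transportCoeff_le (hJ : ∀ n g, (n + 1) * ‖J n g‖ ≤ ε * ‖g‖) (hε : 0 ≤ ε)
    (h u : ℕ → E) (n : ℕ) :
    ‖J n (transportCoeff h u n)‖ ≤ ε * ∑ x ∈ antidiagonal n, ‖h x.1‖ * ‖u x.2‖ := by
  have hn : (0 : ℝ) < n + 1 := by positivity
  refine le_of_mul_le_mul_left ?_ hn
  calc (n + 1) * ‖J n (transportCoeff h u n)‖ ≤ ε * ‖transportCoeff h u n‖ := hJ n _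
    _ ≤ ε * ((n + 1) * ∑ x ∈ antidiagonal n, ‖h x.1‖ * ‖u x.2‖) := by
        gcongr; exact norm_transportCoeff_le h u n
    _ = (n + 1) * (ε * ∑ x ∈ antidiagonal n, ‖h x.1‖ * ‖u x.2‖) := by ring

theorem summable_norm_smoothed_transportCoeff (hJ : ∀ n g, (n + 1) * ‖J n g‖ ≤ ε * ‖g‖)
    (hε : 0 ≤ ε) (hh : Summable fun n => ‖h n‖) (hu : Summable fun n => ‖u n‖) :
    Summable fun n => ‖J n (transportCoeff h u n)‖ :=
  .of_nonneg_of_le (fun _ => norm_nonneg _) (norm_smoothed_transportCoeff_le hJ hε h u)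
    ((summable_sum_mul_antidiagonal_of_summable_norm' hh.norm hh hu.norm hu).mul_left ε)

theorem tsum_norm_smoothed_transportCoeff_le (hJ : ∀ n g, (n + 1) * ‖J n g‖ ≤ ε * ‖g‖)
    (hε : 0 ≤ ε) (hh : Summable fun n => ‖h n‖) (hu : Summable fun n => ‖u n‖) :
    ∑' n, ‖J n (transportCoeff h u n)‖ ≤ ε * ((∑' n, ‖h n‖) * ∑' n, ‖u n‖) := by
  have hprod := summable_sum_mul_antidiagonal_of_summable_norm' hh.norm hh hu.norm hu
  calc ∑' n, ‖J n (transportCoeff h u n)‖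
      ≤ ∑' n, ε * ∑ x ∈ antidiagonal n, ‖h x.1‖ * ‖u x.2‖ :=
        (summable_norm_smoothed_transportCoeff hJ hε hh hu).tsum_le_tsum
          (norm_smoothed_transportCoeff_le hJ hε h u) (hprod.mul_left ε)
    _ = ε * ((∑' n, ‖h n‖) * ∑' n, ‖u n‖) := by
        rw [tsum_mul_left, tsum_mul_tsum_eq_tsum_sum_antidiagonal_of_summable_norm hh.norm hu.norm]

end Transport

section SequenceOperators

variable {E : Type*} [NormedRing E]

theorem memℓp_one_of_summable_norm {u : ℕ → E} (hu : Summable fun n => ‖u n‖) : Memℓp u 1 :=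
  memℓp_gen (by simpa only [ENNReal.toReal_one, Real.rpow_one] using hu)

theorem summable_norm_coe (u : ℓ¹(ℕ, E)) : Summable fun n => ‖u n‖ := by
  simpa only [ENNReal.toReal_one, Real.rpow_one] using (lp.memℓp u).summable (by norm_num)

theorem norm_eq_tsum_norm (u : ℓ¹(ℕ, E)) : ‖u‖ = ∑' n, ‖u n‖ := by
  simpa only [ENNReal.toReal_one, Real.rpow_one, div_one] using
    lp.norm_eq_tsum_rpow (by norm_num) u

/-- `transportCoeff` as a biadditive operation on summable sequences; the smoothing operators `J n`
make up for the loss of a derivative. -/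
noncomputable def smoothedTransportHom (J : ℕ → E →+ E) {ε : ℝ}
    (hJ : ∀ n g, (n + 1) * ‖J n g‖ ≤ ε * ‖g‖) (hε : 0 ≤ ε) : ℓ¹(ℕ, E) →+ ℓ¹(ℕ, E) →+ ℓ¹(ℕ, E) :=
  AddMonoidHom.mk' (fun h => AddMonoidHom.mk' (fun u =>
    ⟨fun n => J n (transportCoeff h u n), memℓp_one_of_summable_norm
      (summable_norm_smoothed_transportCoeff hJ hε (summable_norm_coe h) (summable_norm_coe u))⟩)
    fun u u' => by
      ext n
      simp only [lp.coeFn_add, transportCoeff_add_right, Pi.add_apply, map_add])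
    fun h h' => by
      ext u n
      simp only [lp.coeFn_add, transportCoeff_add_left, Pi.add_apply, map_add,
        AddMonoidHom.mk'_apply, AddMonoidHom.add_apply]

theorem norm_smoothedTransportHom_le {J : ℕ → E →+ E} {ε : ℝ}
    (hJ : ∀ n g, (n + 1) * ‖J n g‖ ≤ ε * ‖g‖) (hε : 0 ≤ ε) (h u : ℓ¹(ℕ, E)) :
    ‖smoothedTransportHom J hJ hε h u‖ ≤ ε * (‖h‖ * ‖u‖) := by
  rw [norm_eq_tsum_norm, norm_eq_tsum_norm h, norm_eq_tsum_norm u]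
  exact tsum_norm_smoothed_transportCoeff_le hJ hε (summable_norm_coe h) (summable_norm_coe u)

variable [StarAddMonoid E] [NormedStarGroup E] [CompleteSpace E]

/-- `herglotzCoeff` as a biadditive operation on summable sequences. -/
noncomputable def herglotzHom (ρ : ℕ → E) (hρ : ∀ m, ‖ρ m‖ ≤ 1) :
    ℓ¹(ℕ, E) →+ ℓ¹(ℕ, E) →+ ℓ¹(ℕ, E) :=
  AddMonoidHom.mk' (fun u => AddMonoidHom.mk' (fun v =>
    ⟨herglotzCoeff ρ u v, memℓp_one_of_summable_norm
      (summable_norm_herglotzCoeff hρ (summable_norm_coe u) (summable_norm_coe v))⟩)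
    fun v v' => Subtype.ext <| herglotzCoeff_add_right hρ (summable_norm_coe u)
      (summable_norm_coe v) (summable_norm_coe v'))
    fun u u' => AddMonoidHom.ext fun v => Subtype.ext <| herglotzCoeff_add_left hρ
      (summable_norm_coe u) (summable_norm_coe u') (summable_norm_coe v)

theorem norm_herglotzHom_le {ρ : ℕ → E} (hρ : ∀ m, ‖ρ m‖ ≤ 1) (u v : ℓ¹(ℕ, E)) :
    ‖herglotzHom ρ hρ u v‖ ≤ 2 * (‖u‖ * ‖v‖) := by
  rw [norm_eq_tsum_norm, norm_eq_tsum_norm u, norm_eq_tsum_norm v]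
  exact tsum_norm_herglotzCoeff_le hρ (summable_norm_coe u) (summable_norm_coe v)

theorem exists_smoothed_transport_herglotz_fixedPoint {ρ : ℕ → E} (hρ : ∀ m, ‖ρ m‖ ≤ 1)
    {J : ℕ → E →+ E} {ε δ R : ℝ} (hJ : ∀ n g, (n + 1) * ‖J n g‖ ≤ ε * ‖g‖) (hε : 0 ≤ ε)
    (hδ : 0 ≤ δ) (u₀ : ℓ¹(ℕ, E)) (hR : ‖u₀‖ + δ ≤ R) (hself : 2 * ε * R ^ 3 ≤ δ)
    (hcontr : 6 * ε * R ^ 2 < 1) :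
    ∃ u : ℓ¹(ℕ, E), ‖u - u₀‖ ≤ δ ∧
      ∀ n, u n = u₀ n + J n (transportCoeff (herglotzCoeff ρ u u) u n) := by
  let T : ℓ¹(ℕ, E) →+ ℓ¹(ℕ, E) →+ ℓ¹(ℕ, E) →+ ℓ¹(ℕ, E) :=
    (AddMonoidHom.compHom (smoothedTransportHom J hJ hε)).comp (herglotzHom ρ hρ)
  have hT : ∀ u v w, ‖T u v w‖ ≤ 2 * ε * (‖u‖ * ‖v‖ * ‖w‖) := fun u v w =>
    calc ‖T u v w‖ ≤ ε * (‖herglotzHom ρ hρ u v‖ * ‖w‖) := norm_smoothedTransportHom_le hJ hε _ w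
      _ ≤ ε * (2 * (‖u‖ * ‖v‖) * ‖w‖) := by gcongr; exact norm_herglotzHom_le hρ u v
      _ = 2 * ε * (‖u‖ * ‖v‖ * ‖w‖) := by ring
  obtain ⟨u, hu, hfixed⟩ :=
    exists_cubic_fixedPoint hT (by positivity) hδ hR hself (by linarith)
  exact ⟨u, hu, fun n => congrArg (fun w : ℓ¹(ℕ, E) => w n) hfixed⟩

end SequenceOperators

section DecayIntegral

variable {F : Type*} [NormedAddCommGroup F] [NormedSpace ℝ F] {b κ L t : ℝ}

/-- The solution operator `g ↦ ∫₀ᵗ exp(-κ(t-τ)) g(τ) dτ` of `w' = -κ w + g`, `w(0) = 0`, on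
`[0, b]`. -/
noncomputable def decayIntegral (hb : 0 ≤ b) (κ : ℝ) : C(Icc (0 : ℝ) b, F) →+ C(Icc (0 : ℝ) b, F) :=
  AddMonoidHom.mk' (fun g =>
    { toFun := fun t => ∫ τ in (0 : ℝ)..t, Real.exp (-κ * (t - τ)) • IccExtend hb g τ
      continuous_toFun := by
        have : Continuous (IccExtend hb g) := g.continuous.Icc_extend'
        have hparametric : Continuous fun t : ℝ =>
            ∫ τ in (0 : ℝ)..t, Real.exp (-κ * (t - τ)) • IccExtend hb g τ :=
          intervalIntegral.continuous_parametric_intervalIntegral_of_continuous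
            (by fun_prop) continuous_id
        exact hparametric.comp continuous_subtype_val })
    fun g h => by
      ext t
      have : Continuous (IccExtend hb g) := g.continuous.Icc_extend'
      have : Continuous (IccExtend hb h) := h.continuous.Icc_extend'
      have hadd : ∀ τ, IccExtend hb (⇑(g + h)) τ = IccExtend hb g τ + IccExtend hb h τ :=
        fun _ => rfl
      simp only [ContinuousMap.coe_mk, ContinuousMap.add_apply, hadd, smul_add]
      exact intervalIntegral.integral_add (Continuous.intervalIntegrable (by fun_prop) _ _)
        (Continuous.intervalIntegrable (by fun_prop) _ _)

theorem norm_decayIntegral_le (hb : 0 ≤ b) {C : ℝ} (hC : 0 ≤ C)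
    (hκ : ∀ t ∈ Icc 0 b, ∫ τ in (0 : ℝ)..t, Real.exp (-κ * (t - τ)) ≤ C)
    (g : C(Icc (0 : ℝ) b, F)) : ‖decayIntegral hb κ g‖ ≤ C * ‖g‖ := by
  rw [ContinuousMap.norm_le _ (by positivity)]
  rintro ⟨t, ht⟩
  calc ‖∫ τ in (0 : ℝ)..t, Real.exp (-κ * (t - τ)) • IccExtend hb g τ‖
      ≤ ∫ τ in (0 : ℝ)..t, Real.exp (-κ * (t - τ)) * ‖g‖ := by
        refine intervalIntegral.norm_integral_le_of_norm_le ht.1 (.of_forall fun τ _ => ?_)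
          (Continuous.intervalIntegrable (by fun_prop) _ _)
        rw [norm_smul, Real.norm_of_nonneg (Real.exp_pos _).le]
        gcongr
        exact g.norm_coe_le_norm _
    _ ≤ C * ‖g‖ := by
        rw [intervalIntegral.integral_mul_const]
        gcongr
        exact hκ t ht

theorem mul_integral_exp_neg (κ t : ℝ) :
    κ * ∫ τ in (0 : ℝ)..t, Real.exp (-κ * (t - τ)) = 1 - Real.exp (-κ * t) := by
  have hderiv : ∀ τ ∈ uIcc 0 t, HasDerivAt (fun τ => Real.exp (-κ * (t - τ)))
      (κ * Real.exp (-κ * (t - τ))) τ := fun τ _ => by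
    simpa [mul_comm] using (((hasDerivAt_id τ).const_sub t).const_mul (-κ)).exp
  rw [← intervalIntegral.integral_const_mul, intervalIntegral.integral_eq_sub_of_hasDerivAt hderiv
    (Continuous.intervalIntegrable (by fun_prop) _ _)]
  simp only [sub_self, mul_zero, Real.exp_zero, sub_zero]

theorem integral_exp_neg_le (hκ : 0 ≤ κ) (ht : 0 ≤ t) :
    ∫ τ in (0 : ℝ)..t, Real.exp (-κ * (t - τ)) ≤ t := by
  have hmono : ∫ τ in (0 : ℝ)..t, Real.exp (-κ * (t - τ)) ≤ ∫ _ in (0 : ℝ)..t, (1 : ℝ) := by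
    refine intervalIntegral.integral_mono_on ht
      (Continuous.intervalIntegrable (by fun_prop) _ _) intervalIntegrable_const fun τ hτ => ?_
    exact Real.exp_le_one_iff.2 (by nlinarith [hτ.2])
  simpa only [intervalIntegral.integral_const, sub_zero, smul_eq_mul, mul_one] using hmono

theorem succ_mul_integral_exp_neg_le (hL : 0 < L) (n : ℕ) (ht : 0 ≤ t) :
    (n + 1) * ∫ τ in (0 : ℝ)..t, Real.exp (-(L * n) * (t - τ)) ≤ t + 1 / L := by
  have hdamped : n * ∫ τ in (0 : ℝ)..t, Real.exp (-(L * n) * (t - τ)) ≤ 1 / L := by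
    rw [le_div_iff₀' hL, ← mul_assoc, mul_integral_exp_neg]
    exact sub_le_self _ (Real.exp_pos _).le
  linarith [integral_exp_neg_le (mul_nonneg hL.le n.cast_nonneg) ht]

theorem succ_mul_norm_decayIntegral_le (hb : 0 ≤ b) (hL : 0 < L) (n : ℕ)
    (g : C(Icc (0 : ℝ) b, F)) :
    (n + 1) * ‖decayIntegral hb (L * n) g‖ ≤ (b + 1 / L) * ‖g‖ := by
  have hn : (0 : ℝ) < n + 1 := by positivity
  rw [← le_div_iff₀' hn, ← div_mul_eq_mul_div]
  refine norm_decayIntegral_le hb (by positivity) (fun t ht => ?_) g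
  rw [le_div_iff₀' hn]
  exact (succ_mul_integral_exp_neg_le hL n ht.1).trans (by gcongr; exact ht.2)

end DecayIntegral

/-- The coefficients of `p_t` in the equation `p_t = z (h p' - h' p) - h p` for the reciprocal
derivative `p = ∑ cₙ zⁿ`, where `h` is analytic with `Re h = |p|²` on the unit circle. -/
noncomputable def velocityCoeff (c : ℕ → ℂ) : ℕ → ℂ := transportCoeff (herglotzCoeff 1 c c) c

section Rescaling

theorem herglotzCoeff_mul_pow {s : ℝ} (hs : s ≠ 0) (c : ℕ → ℂ) (j : ℕ) :
    herglotzCoeff (fun m => ((s : ℂ) ^ (2 * m))⁻¹) (fun n => c n * (s : ℂ) ^ n)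
      (fun n => c n * (s : ℂ) ^ n) j = herglotzCoeff 1 c c j * (s : ℂ) ^ j := by
  have hs' : (s : ℂ) ≠ 0 := by exact_mod_cast hs
  have hterm : ∀ m, c (j + m) * (s : ℂ) ^ (j + m) * star (c m * (s : ℂ) ^ m) *
      ((s : ℂ) ^ (2 * m))⁻¹ = c (j + m) * star (c m) * 1 * (s : ℂ) ^ j := fun m => by
    have hstar : star ((s : ℂ) ^ m) = (s : ℂ) ^ m := by
      rw [star_pow, Complex.star_def, Complex.conj_ofReal]
    rw [star_mul, hstar, pow_add, two_mul, pow_add]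
    field_simp
  simp only [herglotzCoeff, hterm, tsum_mul_right, Pi.one_apply, smul_mul_assoc]

theorem transportCoeff_mul_pow {R : Type*} [CommRing R] (s : R) (h u : ℕ → R) (n : ℕ) :
    transportCoeff (fun k => h k * s ^ k) (fun k => u k * s ^ k) n =
      transportCoeff h u n * s ^ n := by
  simp only [transportCoeff, Finset.sum_mul]
  refine Finset.sum_congr rfl fun x hx => ?_
  rw [← Finset.HasAntidiagonal.mem_antidiagonal.1 hx, smul_mul_assoc, pow_add,
    mul_mul_mul_comm]

variable {K : Type*} [TopologicalSpace K]

theorem transportCoeff_apply (h u : ℕ → C(K, ℂ)) (n : ℕ) (t : K) :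
    transportCoeff h u n t = transportCoeff (fun n => h n t) (fun n => u n t) n := by
  simp only [transportCoeff, ContinuousMap.sum_apply, ContinuousMap.smul_apply,
    ContinuousMap.mul_apply]

variable [CompactSpace K]

theorem herglotzCoeff_apply {ρ u v : ℕ → C(K, ℂ)} (hρ : ∀ m, ‖ρ m‖ ≤ 1)
    (hu : Summable fun n => ‖u n‖) (hv : Summable fun n => ‖v n‖) (j : ℕ) (t : K) :
    herglotzCoeff ρ u v j t =
      herglotzCoeff (fun n => ρ n t) (fun n => u n t) (fun n => v n t) j := by
  simp only [herglotzCoeff, ContinuousMap.smul_apply,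
    ← ContinuousMap.tsum_apply (summable_mul_star_mul hρ hu hv j)]
  rfl

theorem transportCoeff_herglotzCoeff_apply {ρ u : ℕ → C(K, ℂ)} (hρ : ∀ m, ‖ρ m‖ ≤ 1)
    (hu : Summable fun n => ‖u n‖) {t : K} {s : ℝ} (hs : s ≠ 0)
    (hρt : ∀ m, ρ m t = ((s : ℂ) ^ (2 * m))⁻¹) (n : ℕ) :
    transportCoeff (herglotzCoeff ρ u u) u n t =
      velocityCoeff (fun k => u k t / (s : ℂ) ^ k) n * (s : ℂ) ^ n := by
  have hs' : (s : ℂ) ≠ 0 := by exact_mod_cast hs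
  have hut : ∀ k, u k t = u k t / (s : ℂ) ^ k * (s : ℂ) ^ k := fun k =>
    (div_mul_cancel₀ _ (pow_ne_zero k hs')).symm
  rw [transportCoeff_apply, velocityCoeff, ← transportCoeff_mul_pow]
  simp only [herglotzCoeff_apply hρ hu hu, hρt, ← herglotzCoeff_mul_pow hs, ← hut]

end Rescaling

section WeightedSolution

variable {K : Type*} [TopologicalSpace K] [CompactSpace K]

theorem exists_weighted_constant_seq (r : C(K, ℝ)) {s₀ : ℝ} (hr0 : ∀ t, 0 ≤ r t)
    (hrs : ∀ t, r t ≤ s₀) (hs₀ : 0 ≤ s₀) {a : ℕ → ℂ} (ha : Summable fun n => ‖a n‖ * s₀ ^ n) :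
    ∃ u₀ : ℓ¹(ℕ, C(K, ℂ)), (∀ n t, u₀ n t = a n * (r t : ℂ) ^ n) ∧
      ‖u₀‖ ≤ ∑' n, ‖a n‖ * s₀ ^ n := by
  let w : ℕ → C(K, ℂ) := fun n => ⟨fun t => a n * (r t : ℂ) ^ n, by fun_prop⟩
  have hw : ∀ n, ‖w n‖ ≤ ‖a n‖ * s₀ ^ n := fun n => by
    rw [ContinuousMap.norm_le _ (by positivity)]
    intro t
    calc ‖a n * (r t : ℂ) ^ n‖ = ‖a n‖ * r t ^ n := by
          rw [norm_mul, norm_pow, Complex.norm_real, Real.norm_of_nonneg (hr0 t)]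
      _ ≤ ‖a n‖ * s₀ ^ n := by
          have h0 := hr0 t
          have h1 := hrs t
          gcongr
  have hsum : Summable fun n => ‖w n‖ := .of_nonneg_of_le (fun _ => norm_nonneg _) hw ha
  refine ⟨⟨w, memℓp_one_of_summable_norm hsum⟩, fun _ _ => rfl, ?_⟩
  rw [norm_eq_tsum_norm]
  exact hsum.tsum_le_tsum hw ha

theorem exists_inv_pow_weight (r : C(K, ℝ)) (hr : ∀ t, 1 ≤ r t) :
    ∃ ρ : ℕ → C(K, ℂ), (∀ m, ‖ρ m‖ ≤ 1) ∧ ∀ m t, ρ m t = ((r t : ℂ) ^ (2 * m))⁻¹ := by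
  have hne : ∀ t, (r t : ℂ) ≠ 0 := fun t =>
    Complex.ofReal_ne_zero.2 (one_pos.trans_le (hr t)).ne'
  refine ⟨fun m => ⟨fun t => ((r t : ℂ) ^ (2 * m))⁻¹,
    Continuous.inv₀ (by fun_prop) fun t => pow_ne_zero _ (hne t)⟩, fun m => ?_, fun _ _ => rfl⟩
  rw [ContinuousMap.norm_le _ zero_le_one]
  intro t
  rw [ContinuousMap.coe_mk, norm_inv, norm_pow, Complex.norm_real,
    Real.norm_of_nonneg (zero_le_one.trans (hr t))]
  exact inv_le_one_of_one_le₀ (one_le_pow₀ (hr t))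

variable {b L s₀ δ : ℝ} {a : ℕ → ℂ}

theorem exists_weighted_coeff_solution (hb : 0 ≤ b) (hL : 0 < L) (r : C(Icc (0 : ℝ) b, ℝ))
    (hr : ∀ t, 1 ≤ r t) (hrs : ∀ t, r t ≤ s₀) (ha : Summable fun n => ‖a n‖ * s₀ ^ n)
    (hδ : 0 ≤ δ) (hself : 2 * (b + 1 / L) * ((∑' n, ‖a n‖ * s₀ ^ n) + δ) ^ 3 ≤ δ)
    (hcontr : 6 * (b + 1 / L) * ((∑' n, ‖a n‖ * s₀ ^ n) + δ) ^ 2 < 1) :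
    ∃ u : ℓ¹(ℕ, C(Icc (0 : ℝ) b, ℂ)),
      (∀ t, Summable (fun n => ‖u n t - a n * (r t : ℂ) ^ n‖) ∧
        ∑' n, ‖u n t - a n * (r t : ℂ) ^ n‖ ≤ δ) ∧
      ∀ n (t : Icc (0 : ℝ) b), u n t = a n * (r t : ℂ) ^ n +
        ∫ τ in (0 : ℝ)..t, Real.exp (-(L * n) * (t - τ)) • IccExtend hb (fun σ =>
          velocityCoeff (fun k => u k σ / (r σ : ℂ) ^ k) n * (r σ : ℂ) ^ n) τ := by
  have hpos : ∀ t, 0 < r t := fun t => one_pos.trans_le (hr t)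
  have hs₀ : 0 ≤ s₀ := (hpos ⟨0, le_rfl, hb⟩).le.trans (hrs _)
  obtain ⟨u₀, hu₀, hu₀norm⟩ := exists_weighted_constant_seq r (fun t => (hpos t).le) hrs hs₀ ha
  obtain ⟨ρ, hρ, hρr⟩ := exists_inv_pow_weight r hr
  obtain ⟨u, hu, hfixed⟩ := exists_smoothed_transport_herglotz_fixedPoint hρ
    (fun n g => succ_mul_norm_decayIntegral_le hb hL n g) (by positivity) hδ u₀
    (add_le_add_left hu₀norm δ) hself hcontr
  refine ⟨u, fun t => ?_, fun n t => ?_⟩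
  · have hsub : ∀ n, ‖u n t - a n * (r t : ℂ) ^ n‖ ≤ ‖(u - u₀) n‖ := fun n => by
      rw [← hu₀]
      exact ((u - u₀) n).norm_coe_le_norm t
    have hsum := summable_norm_coe (u - u₀)
    have hsum' := Summable.of_nonneg_of_le (fun _ => norm_nonneg _) hsub hsum
    exact ⟨hsum', (hsum'.tsum_le_tsum hsub hsum).trans (norm_eq_tsum_norm (u - u₀) ▸ hu)⟩
  · have hvelocity : ⇑(transportCoeff (herglotzCoeff ρ u u) u n) = fun σ =>
        velocityCoeff (fun k => u k σ / (r σ : ℂ) ^ k) n * (r σ : ℂ) ^ n := funext fun σ =>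
      transportCoeff_herglotzCoeff_apply hρ (summable_norm_coe u) (hpos σ).ne' (hρr · σ) n
    rw [← hvelocity, ← hu₀]
    exact DFunLike.congr_fun (hfixed n) t

end WeightedSolution

section ShrinkingRadius

variable {s₀ s₁ L b t : ℝ}

/-- The radius of the disk on which the power series is controlled at time `t`. -/
noncomputable def shrinkingRadius (s₀ L t : ℝ) : ℝ := s₀ * Real.exp (-(L * t))

theorem shrinkingRadius_le (hs₀ : 0 ≤ s₀) (hL : 0 ≤ L) (ht : 0 ≤ t) :
    shrinkingRadius s₀ L t ≤ s₀ :=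
  mul_le_of_le_one_right hs₀ (Real.exp_le_one_iff.2 (neg_nonpos.2 (mul_nonneg hL ht)))

theorem shrinkingRadius_antitone (hs₀ : 0 ≤ s₀) (hL : 0 ≤ L) : Antitone (shrinkingRadius s₀ L) :=
  fun _ _ hst => mul_le_mul_of_nonneg_left
    (Real.exp_le_exp.2 (neg_le_neg (mul_le_mul_of_nonneg_left hst hL))) hs₀

theorem exp_mul_shrinkingRadius_pow (s₀ L t τ : ℝ) (n : ℕ) :
    Real.exp (-(L * n) * (t - τ)) * shrinkingRadius s₀ L τ ^ n = shrinkingRadius s₀ L t ^ n := by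
  simp only [shrinkingRadius, mul_pow, ← Real.exp_nat_mul]
  rw [mul_left_comm, ← Real.exp_add]
  congr 2
  ring

theorem exists_decay_parameters (hs₁ : s₁ < s₀) {R δ : ℝ} (hδ : 0 < δ) :
    ∃ b > 0, ∃ L > 0, s₁ < shrinkingRadius s₀ L b ∧ 2 * (b + 1 / L) * R ^ 3 < δ ∧
      6 * (b + 1 / L) * R ^ 2 < 1 := by
  have hinv : Tendsto (fun L : ℝ => 0 + 1 / L) atTop (𝓝 0) := by
    simpa using tendsto_inv_atTop_zero (𝕜 := ℝ)
  have hself : ∀ᶠ L : ℝ in atTop, 2 * (0 + 1 / L) * R ^ 3 < δ :=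
    ((hinv.const_mul 2).mul_const (R ^ 3)).eventually_lt_const (by simpa using hδ)
  have hcontr : ∀ᶠ L : ℝ in atTop, 6 * (0 + 1 / L) * R ^ 2 < 1 :=
    ((hinv.const_mul 6).mul_const (R ^ 2)).eventually_lt_const (by simp)
  obtain ⟨L, hselfL, hcontrL, hL⟩ := (hself.and (hcontr.and (eventually_gt_atTop 0))).exists
  have hradius : ∀ᶠ b in 𝓝 (0 : ℝ), s₁ < shrinkingRadius s₀ L b :=
    Tendsto.eventually_const_lt (by simpa [shrinkingRadius] using hs₁)
      (show ContinuousAt (shrinkingRadius s₀ L) 0 by unfold shrinkingRadius; fun_prop)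
  have hselfb : ∀ᶠ b in 𝓝 (0 : ℝ), 2 * (b + 1 / L) * R ^ 3 < δ :=
    (Continuous.tendsto (by fun_prop) 0).eventually_lt_const hselfL
  have hcontrb : ∀ᶠ b in 𝓝 (0 : ℝ), 6 * (b + 1 / L) * R ^ 2 < 1 :=
    (Continuous.tendsto (by fun_prop) 0).eventually_lt_const hcontrL
  obtain ⟨b, h, hb⟩ := (((hradius.and (hselfb.and hcontrb)).filter_mono
    (nhdsWithin_le_nhds (s := Ioi 0))).and self_mem_nhdsWithin).exists
  exact ⟨b, hb, L, hL, h⟩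

end ShrinkingRadius

/-- Uniformly in the parameter `x`, the power series with the continuous coefficients `c x n`
converges normally on the closed disk of radius `s`. -/
structure NormallyConvergent {X : Type*} [TopologicalSpace X] (s : ℝ) (c : X → ℕ → ℂ) : Prop where
  continuous : ∀ n, Continuous fun x => c x n
  exists_bound : ∃ κ : ℕ → ℝ, Summable κ ∧ ∀ x n, ‖c x n‖ * s ^ n ≤ κ n

/-- `p` has initial coefficients `a` and solves the coefficient system with velocity
`velocityCoeff` on `[0, b]`, in integrated form. -/
def IsCoeffSolution (a : ℕ → ℂ) (b : ℝ) (p : ℝ → ℕ → ℂ) : Prop :=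
  ∀ t ∈ Icc 0 b, ∀ n, p t n = a n + ∫ τ in (0 : ℝ)..t, velocityCoeff (p τ) n

section Unweighting

variable {s₀ s₁ L b δ t : ℝ} {a : ℕ → ℂ}

/- `exp(-Ln(t-τ)) r(τ)ⁿ = r(t)ⁿ` turns the damped equation for the weighted coefficients into the
undamped one. -/
theorem isCoeffSolution_unweighted (hs₀ : 0 < s₀) (hb : 0 ≤ b) {u : ℕ → C(Icc (0 : ℝ) b, ℂ)}
    {p : ℝ → ℕ → ℂ}
    (hup : ∀ n (t : Icc (0 : ℝ) b), u n t = p t n * (shrinkingRadius s₀ L t : ℂ) ^ n)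
    (hu : ∀ n (t : Icc (0 : ℝ) b), u n t = a n * (shrinkingRadius s₀ L t : ℂ) ^ n +
      ∫ τ in (0 : ℝ)..t, Real.exp (-(L * n) * (t - τ)) • IccExtend hb (fun σ =>
        velocityCoeff (p σ) n * (shrinkingRadius s₀ L σ : ℂ) ^ n) τ) :
    IsCoeffSolution a b p := by
  intro t ht n
  have hr : (shrinkingRadius s₀ L t : ℂ) ^ n ≠ 0 :=
    pow_ne_zero n (Complex.ofReal_ne_zero.2 (mul_pos hs₀ (Real.exp_pos _)).ne')
  have hintegral : ∫ τ in (0 : ℝ)..t, Real.exp (-(L * n) * (t - τ)) • IccExtend hb (fun σ =>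
        velocityCoeff (p σ) n * (shrinkingRadius s₀ L σ : ℂ) ^ n) τ =
      (∫ τ in (0 : ℝ)..t, velocityCoeff (p τ) n) * (shrinkingRadius s₀ L t : ℂ) ^ n := by
    rw [← intervalIntegral.integral_mul_const]
    refine intervalIntegral.integral_congr fun τ hτ => ?_
    rw [uIcc_of_le ht.1] at hτ
    simp only [IccExtend_of_mem hb _ ⟨hτ.1, hτ.2.trans ht.2⟩, Complex.real_smul]
    rw [mul_left_comm]
    congr 1
    exact_mod_cast exp_mul_shrinkingRadius_pow s₀ L t τ n
  refine mul_right_cancel₀ hr ?_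
  rw [← hup n ⟨t, ht⟩, hu n ⟨t, ht⟩, hintegral, add_mul]

theorem norm_div_pow_mul_pow_le {c : ℂ} {r s : ℝ} (hs : 0 ≤ s) (hsr : s ≤ r) (n : ℕ) :
    ‖c / (r : ℂ) ^ n‖ * s ^ n ≤ ‖c‖ := by
  have hr : 0 ≤ r := hs.trans hsr
  rw [norm_div, norm_pow, Complex.norm_real, Real.norm_of_nonneg hr, div_mul_eq_mul_div,
    mul_div_assoc, ← div_pow]
  exact mul_le_of_le_one_right (norm_nonneg c)
    (pow_le_one₀ (div_nonneg hs hr) (div_le_one_of_le₀ hsr hr))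

theorem normallyConvergent_div_pow {K : Type*} [TopologicalSpace K] [CompactSpace K] (hs₁ : 0 < s₁)
    {r : C(K, ℝ)} (hr : ∀ t, s₁ ≤ r t) (u : ℓ¹(ℕ, C(K, ℂ))) :
    NormallyConvergent s₁ fun t n => u n t / (r t : ℂ) ^ n where
  continuous n := Continuous.div (by fun_prop) (by fun_prop) fun t =>
    pow_ne_zero n (Complex.ofReal_ne_zero.2 (hs₁.trans_le (hr t)).ne')
  exists_bound := ⟨fun n => ‖u n‖, summable_norm_coe u,
    fun t n => (norm_div_pow_mul_pow_le hs₁.le (hr t) n).trans ((u n).norm_coe_le_norm t)⟩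

theorem NormallyConvergent.comp {X Y : Type*} [TopologicalSpace X] [TopologicalSpace Y]
    {c : X → ℕ → ℂ} (hc : NormallyConvergent s₁ c) {g : Y → X} (hg : Continuous g) :
    NormallyConvergent s₁ fun y => c (g y) where
  continuous n := (hc.continuous n).comp hg
  exists_bound := hc.exists_bound.imp fun _ h => ⟨h.1, fun y => h.2 (g y)⟩

theorem tsum_norm_div_pow_sub_le {c : ℕ → ℂ} {r : ℝ} (hs₁ : 0 < s₁) (hr : s₁ ≤ r)
    (hc : Summable fun n => ‖c n - a n * (r : ℂ) ^ n‖)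
    (hδ : ∑' n, ‖c n - a n * (r : ℂ) ^ n‖ ≤ δ) :
    ∑' n, ‖c n / (r : ℂ) ^ n - a n‖ * s₁ ^ n ≤ δ := by
  have hle : ∀ n, ‖c n / (r : ℂ) ^ n - a n‖ * s₁ ^ n ≤ ‖c n - a n * (r : ℂ) ^ n‖ := fun n => by
    have hrn : (r : ℂ) ^ n ≠ 0 := pow_ne_zero n (Complex.ofReal_ne_zero.2 (hs₁.trans_le hr).ne')
    rw [div_sub' hrn, mul_comm _ (a n)]
    exact norm_div_pow_mul_pow_le hs₁.le hr n
  exact ((Summable.of_nonneg_of_le (fun n => by positivity) hle hc).tsum_le_tsum hle hc).trans hδ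

theorem exists_coeff_solution (hs₁ : 1 ≤ s₁) (hs : s₁ < s₀)
    (ha : Summable fun n => ‖a n‖ * s₀ ^ n) (hδ : 0 < δ) :
    ∃ b > 0, ∃ p : ℝ → ℕ → ℂ, NormallyConvergent s₁ p ∧
      (∀ t, ∑' n, ‖p t n - a n‖ * s₁ ^ n ≤ δ) ∧ IsCoeffSolution a b p := by
  obtain ⟨b, hb, L, hL, hsb, hself, hcontr⟩ :=
    exists_decay_parameters hs (R := (∑' n, ‖a n‖ * s₀ ^ n) + δ) hδ
  have hs₁' : 0 < s₁ := one_pos.trans_le hs₁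
  have hs₀ : 0 < s₀ := hs₁'.trans hs
  let r : C(Icc (0 : ℝ) b, ℝ) :=
    ⟨fun t => shrinkingRadius s₀ L t, by unfold shrinkingRadius; fun_prop⟩
  have hr : ∀ t, s₁ ≤ r t := fun t =>
    hsb.le.trans (shrinkingRadius_antitone hs₀.le hL.le t.2.2)
  have hrs : ∀ t, r t ≤ s₀ := fun t => shrinkingRadius_le hs₀.le hL.le t.2.1
  obtain ⟨u, hclose, hu⟩ := exists_weighted_coeff_solution hb.le hL r
    (fun t => hs₁.trans (hr t)) hrs ha hδ.le hself.le hcontr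
  have hr_ne : ∀ t n, (r t : ℂ) ^ n ≠ 0 := fun t n =>
    pow_ne_zero n (Complex.ofReal_ne_zero.2 (hs₁'.trans_le (hr t)).ne')
  let π := projIcc 0 b hb.le
  have hπ : ∀ t : Icc (0 : ℝ) b, π t = t := projIcc_val hb.le
  refine ⟨b, hb, fun t n => u n (π t) / (r (π t) : ℂ) ^ n,
    (normallyConvergent_div_pow hs₁' hr u).comp continuous_projIcc, fun t => ?_, ?_⟩
  · exact tsum_norm_div_pow_sub_le hs₁' (hr _) (hclose (π t)).1 (hclose (π t)).2
  · refine isCoeffSolution_unweighted hs₀ hb.le (u := u) (L := L) (fun n t => ?_) ?_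
    · rw [hπ]
      exact (div_mul_cancel₀ _ (hr_ne t n)).symm
    · simp only [hπ]
      exact hu

end Unweighting

section HerglotzIdentity

theorem tsum_prod_nat_eq_tsum_diagonals {E : Type*} [NormedAddCommGroup E] [CompleteSpace E]
    {F : ℕ × ℕ → E} (hF : Summable F) :
    ∑' x, F x = (∑' j, ∑' m, F (j + m, m)) + ∑' j, ∑' m, F (m, j + 1 + m) := by
  let lower : ℕ × ℕ → ℕ × ℕ := fun x => (x.1 + x.2, x.2)
  let upper : ℕ × ℕ → ℕ × ℕ := fun x => (x.2, x.1 + 1 + x.2)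
  have hlower : lower.Injective := fun x y h => by
    simp only [lower, Prod.mk.injEq] at h
    ext <;> omega
  have hupper : upper.Injective := fun x y h => by
    simp only [upper, Prod.mk.injEq] at h
    ext <;> omega
  have hcompl : (range lower)ᶜ = range upper := by
    ext ⟨n, m⟩
    simp only [mem_compl_iff, mem_range, Prod.exists, lower, upper, Prod.mk.injEq]
    constructor
    · intro h
      have hnm : ¬ m ≤ n := fun hmn => h ⟨n - m, m, by omega, rfl⟩
      exact ⟨m - n - 1, n, rfl, by omega⟩
    · rintro ⟨i, j, hi, hj⟩ ⟨k, l, hk, hl⟩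
      omega
  rw [← (hF.subtype _).tsum_add_tsum_compl (s := range lower) (hF.subtype _), hcompl,
    tsum_range F hlower, tsum_range F hupper]
  exact congrArg₂ (· + ·) (hF.comp_injective hlower).tsum_prod
    (hF.comp_injective hupper).tsum_prod

theorem ofReal_norm_sq_tsum {c : ℕ → ℂ} (hc : Summable fun n => ‖c n‖) :
    ((‖∑' n, c n‖ ^ 2 : ℝ) : ℂ) = (∑' j, ∑' m, c (j + m) * star (c m)) +
      star (∑' j, ∑' m, c (j + 1 + m) * star (c m)) := by
  have hstar : Summable fun n => ‖star (c n)‖ := by simpa only [norm_star] using hc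
  calc ((‖∑' n, c n‖ ^ 2 : ℝ) : ℂ) = (∑' n, c n) * ∑' n, star (c n) := by
        rw [← tsum_star]
        exact_mod_cast (Complex.mul_conj' _).symm
    _ = ∑' x : ℕ × ℕ, c x.1 * star (c x.2) :=
        tsum_mul_tsum_of_summable_norm (g := fun n => star (c n)) hc hstar
    _ = _ := by
        rw [tsum_prod_nat_eq_tsum_diagonals
          (summable_mul_of_summable_norm (g := fun n => star (c n)) hc hstar)]
        simp only [tsum_star, star_mul, star_star]

theorem tsum_herglotzCoeff {c : ℕ → ℂ} (hc : Summable fun n => ‖c n‖) :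
    ∑' j, herglotzCoeff 1 c c j = (∑' j, ∑' m, c (j + m) * star (c m)) +
      ∑' j, ∑' m, c (j + 1 + m) * star (c m) := by
  have hone : ∀ m, ‖(1 : ℕ → ℂ) m‖ ≤ 1 := fun _ => norm_one.le
  have hherglotz := (summable_norm_herglotzCoeff hone hc hc).of_norm
  have hcorr : Summable fun j => ∑' m, c (j + m) * star (c m) :=
    Summable.prod (f := fun x : ℕ × ℕ => c (x.1 + x.2) * star (c x.2)) <|
      .of_norm_bounded (summable_add_mul hc hc (fun _ => norm_nonneg _) fun _ => norm_nonneg _)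
        fun x => by rw [norm_mul, norm_star]
  have hzero : herglotzCoeff 1 c c 0 = ∑' m, c (0 + m) * star (c m) := by
    simp only [herglotzCoeff, if_true, one_smul, Pi.one_apply, mul_one]
  have hsucc : ∀ j, herglotzCoeff 1 c c (j + 1) = 2 * ∑' m, c (j + 1 + m) * star (c m) :=
    fun j => by
      simp only [herglotzCoeff, Nat.succ_ne_zero, if_false, Pi.one_apply, mul_one, nsmul_eq_mul,
        Nat.cast_ofNat]
  rw [hherglotz.tsum_eq_zero_add, hcorr.tsum_eq_zero_add, hzero]
  simp only [hsucc, tsum_mul_left]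
  ring

theorem re_tsum_herglotzCoeff {c : ℕ → ℂ} (hc : Summable fun n => ‖c n‖) :
    (∑' j, herglotzCoeff 1 c c j).re = ‖∑' n, c n‖ ^ 2 := by
  rw [← Complex.ofReal_re (_ ^ 2), ofReal_norm_sq_tsum hc, tsum_herglotzCoeff hc, Complex.add_re,
    Complex.add_re]
  rfl

theorem herglotzCoeff_mul_pow_of_norm_eq_one {z : ℂ} (hz : ‖z‖ = 1) (c : ℕ → ℂ) (j : ℕ) :
    herglotzCoeff 1 (fun n => c n * z ^ n) (fun n => c n * z ^ n) j =
      herglotzCoeff 1 c c j * z ^ j := by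
  have hunit : ∀ m : ℕ, z ^ m * star (z ^ m) = 1 := fun m => by
    rw [Complex.star_def, Complex.mul_conj', norm_pow, hz]
    norm_num
  have hterm : ∀ m, c (j + m) * z ^ (j + m) * star (c m * z ^ m) * 1 =
      c (j + m) * star (c m) * 1 * z ^ j := fun m => by
    rw [star_mul, pow_add]
    linear_combination c (j + m) * star (c m) * z ^ j * hunit m
  simp only [herglotzCoeff, Pi.one_apply, hterm, tsum_mul_right, smul_mul_assoc]

theorem re_tsum_herglotzCoeff_mul_pow {c : ℕ → ℂ} {z : ℂ} (hz : ‖z‖ = 1)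
    (hc : Summable fun n => ‖c n‖) :
    (∑' j, herglotzCoeff 1 c c j * z ^ j).re = ‖∑' n, c n * z ^ n‖ ^ 2 := by
  simp only [← herglotzCoeff_mul_pow_of_norm_eq_one hz]
  exact re_tsum_herglotzCoeff (by simpa only [norm_mul, norm_pow, hz, one_pow, mul_one] using hc)

theorem im_herglotzCoeff_zero {c : ℕ → ℂ} (hc : Summable fun n => ‖c n‖) :
    (herglotzCoeff 1 c c 0).im = 0 := by
  have hsum := summable_mul_star_mul (ρ := 1) (fun _ => norm_one.le) hc hc 0
  simp only [herglotzCoeff, if_true, one_smul, Complex.im_tsum hsum]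
  simp [Complex.mul_conj]

end HerglotzIdentity

section PowerSum

/-- The sum of the power series with coefficients `c`. -/
noncomputable def powerSum (c : ℕ → ℂ) (z : ℂ) : ℂ := ∑' n, c n * z ^ n

variable {c : ℕ → ℂ} {s r : ℝ} {z : ℂ}

theorem powerSum_zero (c : ℕ → ℂ) : powerSum c 0 = c 0 := by
  rw [powerSum, tsum_eq_single 0 fun n hn => by rw [zero_pow hn, mul_zero], pow_zero, mul_one]

theorem norm_mul_pow_le (c : ℂ) (hz : ‖z‖ ≤ s) (n : ℕ) : ‖c * z ^ n‖ ≤ ‖c‖ * s ^ n := by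
  rw [norm_mul, norm_pow]
  gcongr

theorem summable_norm_mul_pow (hc : Summable fun n => ‖c n‖ * s ^ n) (hz : ‖z‖ ≤ s) :
    Summable fun n => ‖c n * z ^ n‖ :=
  .of_nonneg_of_le (fun _ => norm_nonneg _) (fun n => norm_mul_pow_le (c n) hz n) hc

theorem norm_powerSum_le (hc : Summable fun n => ‖c n‖ * s ^ n) (hz : ‖z‖ ≤ s) :
    ‖powerSum c z‖ ≤ ∑' n, ‖c n‖ * s ^ n :=
  tsum_of_norm_bounded hc.hasSum fun n => norm_mul_pow_le (c n) hz n

theorem powerSum_sub {c' : ℕ → ℂ} (hc : Summable fun n => c n * z ^ n)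
    (hc' : Summable fun n => c' n * z ^ n) :
    powerSum c z - powerSum c' z = powerSum (fun n => c n - c' n) z := by
  simp only [powerSum, sub_mul, hc.tsum_sub hc']

theorem differentiableOn_powerSum (hc : Summable fun n => ‖c n‖ * s ^ n) :
    DifferentiableOn ℂ (powerSum c) (Metric.ball 0 s) :=
  Complex.differentiableOn_tsum_of_summable_norm hc (fun _ => by fun_prop) Metric.isOpen_ball
    fun n _ hw => norm_mul_pow_le (c n) (mem_ball_zero_iff.1 hw).le n

theorem hasSum_mul_deriv_powerSum (hc : Summable fun n => ‖c n‖ * s ^ n)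
    (hz : z ∈ Metric.ball 0 s) :
    HasSum (fun n => n * (c n * z ^ n)) (z * deriv (powerSum c) z) := by
  have hderiv := (Complex.hasSum_deriv_of_summable_norm hc (F := fun n w => c n * w ^ n)
    (fun _ => by fun_prop) Metric.isOpen_ball
    (fun n _ hw => norm_mul_pow_le (c n) (mem_ball_zero_iff.1 hw).le n) hz).mul_left z
  refine hderiv.congr_fun ?_
  rintro (_ | n)
  · simp
  · simp only [deriv_const_mul_field', deriv_pow_field, Nat.add_sub_cancel]
    ring

theorem exists_eqOn_powerSum {g : ℂ → ℂ} (hg : DifferentiableOn ℂ g (Metric.ball 0 r))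
    (hs : 0 ≤ s) (hsr : s < r) :
    ∃ a : ℕ → ℂ, (Summable fun n => ‖a n‖ * s ^ n) ∧ EqOn (powerSum a) g (Metric.ball 0 r) := by
  have htaylor : ∀ z ∈ Metric.ball (0 : ℂ) r,
      HasSum (fun n : ℕ => (n.factorial : ℂ)⁻¹ * iteratedDeriv n g 0 * z ^ n) (g z) := by
    intro z hz
    refine (Complex.hasSum_taylorSeries_on_ball hg hz).congr_fun fun n => ?_
    rw [sub_zero, smul_eq_mul, smul_eq_mul]
    ring
  refine ⟨_, ?_, fun z hz => (htaylor z hz).tsum_eq⟩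
  have hs' : ‖(s : ℂ)‖ = s := by rw [Complex.norm_real, Real.norm_of_nonneg hs]
  simpa only [norm_mul, norm_pow, hs'] using
    (htaylor s (mem_ball_zero_iff.2 (hs'.trans_lt hsr))).summable.norm

/-- The right-hand side of the equation `p_t = z (h p' - h' p) - h p` satisfied by the reciprocal
`p = 1 / f'` of the derivative of a solution of the Polubarinova–Galin equation. -/
noncomputable def transportField (h p : ℂ → ℂ) (z : ℂ) : ℂ :=
  h z * (z * deriv p z) - z * deriv h z * p z - h z * p z

theorem powerSum_transportCoeff {h p : ℕ → ℂ} (hh : Summable fun n => ‖h n‖ * s ^ n)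
    (hp : Summable fun n => ‖p n‖ * s ^ n) (hz : z ∈ Metric.ball 0 s) :
    powerSum (transportCoeff h p) z = transportField (powerSum h) (powerSum p) z := by
  have hh_norm := summable_norm_mul_pow hh (mem_ball_zero_iff.1 hz).le
  have hp_norm := summable_norm_mul_pow hp (mem_ball_zero_iff.1 hz).le
  have hh' := hasSum_mul_deriv_powerSum hh hz
  have hp' := hasSum_mul_deriv_powerSum hp hz
  rw [transportField, ← hh'.tsum_eq, ← hp'.tsum_eq, powerSum, powerSum, powerSum,
    tsum_mul_tsum_eq_tsum_sum_antidiagonal_of_summable_norm hh_norm hp'.summable.norm,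
    tsum_mul_tsum_eq_tsum_sum_antidiagonal_of_summable_norm hh'.summable.norm hp_norm,
    tsum_mul_tsum_eq_tsum_sum_antidiagonal_of_summable_norm hh_norm hp_norm]
  have hsum₁ := (summable_norm_sum_mul_antidiagonal_of_summable_norm hh_norm
    hp'.summable.norm).of_norm
  have hsum₂ := (summable_norm_sum_mul_antidiagonal_of_summable_norm hh'.summable.norm
    hp_norm).of_norm
  have hsum₃ := (summable_norm_sum_mul_antidiagonal_of_summable_norm hh_norm hp_norm).of_norm
  rw [← hsum₁.tsum_sub hsum₂, ← (hsum₁.sub hsum₂).tsum_sub hsum₃]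
  refine tsum_congr fun n => ?_
  rw [transportCoeff, Finset.sum_mul, ← Finset.sum_sub_distrib, ← Finset.sum_sub_distrib]
  refine Finset.sum_congr rfl fun x hx => ?_
  rw [← Finset.HasAntidiagonal.mem_antidiagonal.1 hx, pow_add, zsmul_eq_mul]
  push_cast
  ring

end PowerSum

section NormallyConvergent

variable {X : Type*} [TopologicalSpace X] {s s' : ℝ} {c h p : X → ℕ → ℂ}

theorem NormallyConvergent.summable (hc : NormallyConvergent s c) (hs : 0 ≤ s) (x : X) :
    Summable fun n => ‖c x n‖ * s ^ n :=
  let ⟨_, hκ, hle⟩ := hc.exists_bound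
  .of_nonneg_of_le (fun _ => by positivity) (hle x) hκ

theorem NormallyConvergent.mono (hc : NormallyConvergent s c) (hs' : 0 ≤ s') (hss : s' ≤ s) :
    NormallyConvergent s' c where
  continuous := hc.continuous
  exists_bound := hc.exists_bound.imp fun _ h => ⟨h.1, fun x n =>
    (mul_le_mul_of_nonneg_left (pow_le_pow_left₀ hs' hss n) (norm_nonneg _)).trans (h.2 x n)⟩

theorem NormallyConvergent.continuousOn_powerSum (hc : NormallyConvergent s c) :
    ContinuousOn (fun q : X × ℂ => powerSum (c q.1) q.2) (univ ×ˢ Metric.closedBall 0 s) := by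
  obtain ⟨κ, hκ, hle⟩ := hc.exists_bound
  refine continuousOn_tsum (fun n => ?_) hκ fun n q hq =>
    (norm_mul_pow_le _ (mem_closedBall_zero_iff.1 hq.2) n).trans (hle q.1 n)
  have := hc.continuous n
  exact Continuous.continuousOn (by fun_prop)

theorem NormallyConvergent.exists_nonneg_bound (hc : NormallyConvergent s c) :
    ∃ κ : ℕ → ℝ, Summable κ ∧ (∀ n, 0 ≤ κ n) ∧ ∀ x n, ‖c x n‖ * s ^ n ≤ κ n :=
  let ⟨κ, hκ, hle⟩ := hc.exists_bound
  ⟨fun n => |κ n|, hκ.abs, fun _ => abs_nonneg _, fun x n => (hle x n).trans (le_abs_self _)⟩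

theorem norm_herglotzCoeff_mul_pow_le {u : ℕ → ℂ} {κ : ℕ → ℝ} (hs : 1 ≤ s) (hκ : Summable κ)
    (hκ0 : ∀ n, 0 ≤ κ n) (hle : ∀ n, ‖u n‖ * s ^ n ≤ κ n) (j : ℕ) :
    ‖herglotzCoeff 1 u u j‖ * s ^ j ≤ 2 * ∑' m, κ (j + m) * κ m := by
  have hnorm : ∀ n, ‖u n‖ ≤ κ n := fun n =>
    (le_mul_of_one_le_right (norm_nonneg _) (one_le_pow₀ hs)).trans (hle n)
  have hshift : ∀ m, ‖u (j + m)‖ * s ^ j ≤ κ (j + m) := fun m =>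
    (mul_le_mul_of_nonneg_left (pow_le_pow_right₀ hs (Nat.le_add_right j m))
      (norm_nonneg _)).trans (hle (j + m))
  have hu : Summable fun n => ‖u n‖ := .of_nonneg_of_le (fun _ => norm_nonneg _) hnorm hκ
  have huu := (summable_add_mul hu hu (fun _ => norm_nonneg _) fun _ => norm_nonneg _).prod_factor j
  have hκκ := (summable_add_mul hκ hκ hκ0 hκ0).prod_factor j
  calc ‖herglotzCoeff 1 u u j‖ * s ^ j
      ≤ (2 * ∑' m, ‖u (j + m)‖ * ‖u m‖) * s ^ j := by
        have := zero_le_one.trans hs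
        gcongr
        exact norm_herglotzCoeff_le (fun _ => norm_one.le) huu
    _ = 2 * ∑' m, ‖u (j + m)‖ * s ^ j * ‖u m‖ := by
        rw [mul_assoc, ← tsum_mul_right]
        simp only [mul_right_comm]
    _ ≤ 2 * ∑' m, κ (j + m) * κ m := by
        refine mul_le_mul_of_nonneg_left (Summable.tsum_le_tsum (fun m => ?_) ?_ hκκ) zero_le_two
        · exact mul_le_mul (hshift m) (hnorm m) (norm_nonneg _) (hκ0 _)
        · simpa only [mul_right_comm] using huu.mul_right (s ^ j)

theorem NormallyConvergent.herglotzCoeff (hc : NormallyConvergent s c) (hs : 1 ≤ s) :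
    NormallyConvergent s fun x => herglotzCoeff 1 (c x) (c x) := by
  obtain ⟨κ, hκ, hκ0, hle⟩ := hc.exists_nonneg_bound
  have hκκ := summable_add_mul hκ hκ hκ0 hκ0
  refine ⟨fun j => ?_, _, hκκ.prod.mul_left 2,
    fun x => norm_herglotzCoeff_mul_pow_le hs hκ hκ0 (hle x)⟩
  have hnorm : ∀ x n, ‖c x n‖ ≤ κ n := fun x n =>
    (le_mul_of_one_le_right (norm_nonneg _) (one_le_pow₀ hs)).trans (hle x n)
  refine (continuous_tsum (fun m => ?_) (hκκ.prod_factor j) fun m x => ?_).const_smul _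
  · exact ((hc.continuous (j + m)).mul (hc.continuous m).star).mul continuous_const
  · exact (norm_mul_star_mul_le norm_one.le).trans
      (mul_le_mul (hnorm x _) (hnorm x m) (norm_nonneg _) (hκ0 _))

theorem succ_mul_pow_le (hs' : 0 ≤ s') (hss : s' < s) (n : ℕ) :
    (n + 1) * s' ^ n ≤ s / (s - s') * s ^ n := by
  rw [div_mul_eq_mul_div, le_div_iff₀ (sub_pos.2 hss), ← pow_succ']
  induction n with
  | zero => simpa using hs'
  | succ n ih =>
    have hpow : s' ^ (n + 1) ≤ s ^ (n + 1) := pow_le_pow_left₀ hs' hss.le _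
    calc ((n + 1 : ℕ) + 1) * s' ^ (n + 1) * (s - s')
        = s' * ((n + 1) * s' ^ n * (s - s')) + s' ^ (n + 1) * (s - s') := by push_cast; ring
      _ ≤ s' * s ^ (n + 1) + s ^ (n + 1) * (s - s') := by
          have := sub_nonneg.2 hss.le
          gcongr
      _ = s ^ (n + 1 + 1) := by ring

theorem norm_transportCoeff_mul_pow_le {u v : ℕ → ℂ} {η κ : ℕ → ℝ} (hs' : 0 ≤ s') (hss : s' < s)
    (hη : ∀ n, 0 ≤ η n) (hu : ∀ n, ‖u n‖ * s ^ n ≤ η n) (hv : ∀ n, ‖v n‖ * s ^ n ≤ κ n) (n : ℕ) :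
    ‖transportCoeff u v n‖ * s' ^ n ≤
      s / (s - s') * ∑ x ∈ antidiagonal n, η x.1 * κ x.2 := by
  have hs : 0 < s := hs'.trans_lt hss
  have hterm : ∀ x ∈ antidiagonal n, ‖u x.1‖ * ‖v x.2‖ * s ^ n ≤ η x.1 * κ x.2 := fun x hx => by
    rw [← Finset.HasAntidiagonal.mem_antidiagonal.1 hx, pow_add, mul_mul_mul_comm]
    exact mul_le_mul (hu _) (hv _) (by positivity) (hη _)
  calc ‖transportCoeff u v n‖ * s' ^ n
      ≤ ((n + 1) * ∑ x ∈ antidiagonal n, ‖u x.1‖ * ‖v x.2‖) * s' ^ n := by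
        gcongr
        exact norm_transportCoeff_le u v n
    _ = ((n + 1) * s' ^ n) * ∑ x ∈ antidiagonal n, ‖u x.1‖ * ‖v x.2‖ := by ring
    _ ≤ (s / (s - s') * s ^ n) * ∑ x ∈ antidiagonal n, ‖u x.1‖ * ‖v x.2‖ :=
        mul_le_mul_of_nonneg_right (succ_mul_pow_le hs' hss n)
          (Finset.sum_nonneg fun _ _ => by positivity)
    _ = s / (s - s') * ∑ x ∈ antidiagonal n, ‖u x.1‖ * ‖v x.2‖ * s ^ n := by
        rw [← Finset.sum_mul]
        ring
    _ ≤ s / (s - s') * ∑ x ∈ antidiagonal n, η x.1 * κ x.2 :=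
        mul_le_mul_of_nonneg_left (Finset.sum_le_sum hterm) (div_pos hs (sub_pos.2 hss)).le

theorem NormallyConvergent.transportCoeff (hh : NormallyConvergent s h)
    (hp : NormallyConvergent s p) (hs' : 0 ≤ s') (hss : s' < s) :
    NormallyConvergent s' fun x => transportCoeff (h x) (p x) := by
  obtain ⟨η, hη, hη0, hhη⟩ := hh.exists_nonneg_bound
  obtain ⟨κ, hκ, hκ0, hpκ⟩ := hp.exists_nonneg_bound
  refine ⟨fun n => ?_, _, (summable_sum_mul_antidiagonal_of_summable_mul
    (hη.mul_of_nonneg hκ hη0 hκ0)).mul_left (s / (s - s')),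
    fun x => norm_transportCoeff_mul_pow_le hs' hss hη0 (hhη x) (hpκ x)⟩
  exact continuous_finsetSum _ fun x _ =>
    ((hh.continuous x.1).mul (hp.continuous x.2)).const_smul _

end NormallyConvergent

section ReciprocalSolution

/-- The reciprocal form of the Polubarinova–Galin equation on `|z| < s`, `0 ≤ t ≤ b`: here `p`
stands for `1 / f'`, and `h t` is the function analytic in the disk with `Re h = |p|²` on the unit
circle and `h t 0` real. Continuity is required for all real times, where `p` and `h` are extended
constantly outside `[0, b]`. -/
structure IsReciprocalSolution (b s : ℝ) (p h : ℝ → ℂ → ℂ) : Prop where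
  continuousOn_p : ContinuousOn (fun q : ℝ × ℂ => p q.1 q.2) (univ ×ˢ Metric.ball 0 s)
  continuousOn_h : ContinuousOn (fun q : ℝ × ℂ => h q.1 q.2) (univ ×ˢ Metric.ball 0 s)
  continuousOn_transportField : ContinuousOn
    (fun q : ℝ × ℂ => transportField (h q.1) (p q.1) q.2) (univ ×ˢ Metric.ball 0 s)
  differentiableOn_p : ∀ t, DifferentiableOn ℂ (p t) (Metric.ball 0 s)
  differentiableOn_h : ∀ t, DifferentiableOn ℂ (h t) (Metric.ball 0 s)
  hasDerivWithinAt : ∀ z ∈ Metric.ball (0 : ℂ) s, ∀ t ∈ Icc 0 b,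
    HasDerivWithinAt (fun τ => p τ z) (transportField (h t) (p t) z) (Icc 0 b) t
  re_h : ∀ t z, ‖z‖ = 1 → (h t z).re = ‖p t z‖ ^ 2
  im_h_zero : ∀ t, (h t 0).im = 0

variable {a : ℕ → ℂ} {b s s₁ t : ℝ} {c : ℝ → ℕ → ℂ} {z : ℂ}

theorem IsCoeffSolution.hasDerivWithinAt_powerSum (hc : IsCoeffSolution a b c)
    (hvel : NormallyConvergent s fun t => velocityCoeff (c t)) (ht : t ∈ Icc 0 b) (hz : ‖z‖ ≤ s)
    (hsum : Summable fun n => c t n * z ^ n) :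
    HasDerivWithinAt (fun τ => powerSum (c τ) z) (powerSum (velocityCoeff (c t)) z)
      (Icc 0 b) t := by
  obtain ⟨κ, hκ, hle⟩ := hvel.exists_bound
  have hterm : ∀ n τ, HasDerivAt
      (fun τ => (a n + ∫ σ in (0 : ℝ)..τ, velocityCoeff (c σ) n) * z ^ n)
      (velocityCoeff (c τ) n * z ^ n) τ := fun n τ =>
    (((hvel.continuous n).integral_hasStrictDerivAt 0 τ).hasDerivAt.const_add (a n)).mul_const _
  have hderiv := hasDerivAt_tsum hκ hterm
    (fun n τ => (norm_mul_pow_le _ hz n).trans (hle τ n))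
    (hsum.congr fun n => by rw [hc t ht n]) t
  have hEq : EqOn (fun τ => powerSum (c τ) z)
      (fun τ => ∑' n, (a n + ∫ σ in (0 : ℝ)..τ, velocityCoeff (c σ) n) * z ^ n) (Icc 0 b) :=
    fun τ hτ => tsum_congr fun n => by rw [hc τ hτ n]
  exact hderiv.hasDerivWithinAt.congr hEq (hEq ht)

theorem IsCoeffSolution.isReciprocalSolution (hc : IsCoeffSolution a b c)
    (hconv : NormallyConvergent s₁ c) (hs : 1 ≤ s) (hss : s < s₁) :
    IsReciprocalSolution b s (fun t => powerSum (c t))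
      (fun t => powerSum (herglotzCoeff 1 (c t) (c t))) := by
  have hs0 : 0 ≤ s := zero_le_one.trans hs
  have hs₁ : 1 ≤ s₁ := hs.trans hss.le
  have hconv' := hconv.mono hs0 hss.le
  have hh := hconv.herglotzCoeff hs₁
  have hh' := hh.mono hs0 hss.le
  have hvel := hh.transportCoeff hconv hs0 hss
  have hℓ1 : ∀ t, Summable fun n => ‖c t n‖ := fun t => by
    simpa only [one_pow, mul_one] using (hconv.mono zero_le_one hs₁).summable zero_le_one t
  have hfield : ∀ t, ∀ z ∈ Metric.ball (0 : ℂ) s, powerSum (velocityCoeff (c t)) z =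
      transportField (powerSum (herglotzCoeff 1 (c t) (c t))) (powerSum (c t)) z := fun t z =>
    powerSum_transportCoeff (hh'.summable hs0 t) (hconv'.summable hs0 t)
  have hsub : univ ×ˢ Metric.ball 0 s ⊆ (univ : Set ℝ) ×ˢ Metric.closedBall (0 : ℂ) s :=
    prod_mono subset_rfl Metric.ball_subset_closedBall
  exact
    { continuousOn_p := hconv'.continuousOn_powerSum.mono hsub
      continuousOn_h := hh'.continuousOn_powerSum.mono hsub
      continuousOn_transportField := (hvel.continuousOn_powerSum.mono hsub).congr
        fun q hq => (hfield q.1 q.2 hq.2).symm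
      differentiableOn_p := fun t => differentiableOn_powerSum (hconv'.summable hs0 t)
      differentiableOn_h := fun t => differentiableOn_powerSum (hh'.summable hs0 t)
      hasDerivWithinAt := fun z hz t ht => by
        rw [← hfield t z hz]
        have hzs : ‖z‖ ≤ s := (mem_ball_zero_iff.1 hz).le
        exact hc.hasDerivWithinAt_powerSum hvel ht hzs
          (summable_norm_mul_pow (hconv'.summable hs0 t) hzs).of_norm
      re_h := fun t z hz => re_tsum_herglotzCoeff_mul_pow hz (hℓ1 t)
      im_h_zero := fun t => by rw [powerSum_zero, im_herglotzCoeff_zero (hℓ1 t)] }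

theorem exists_reciprocal_solution {p₀ : ℂ → ℂ} {r δ : ℝ}
    (hp₀ : DifferentiableOn ℂ p₀ (Metric.ball 0 r)) (hs : 1 ≤ s) (hsr : s < r) (hδ : 0 < δ) :
    ∃ b > 0, ∃ p h : ℝ → ℂ → ℂ, IsReciprocalSolution b s p h ∧
      EqOn (p 0) p₀ (Metric.ball 0 s) ∧ ∀ t, ∀ z ∈ Metric.ball 0 s, ‖p t z - p₀ z‖ ≤ δ := by
  obtain ⟨s₀, hss₀, hs₀r⟩ := exists_between hsr
  obtain ⟨s₁, hss₁, hs₁₀⟩ := exists_between hss₀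
  have hs₁ : 1 ≤ s₁ := hs.trans hss₁.le
  have hs₁0 : 0 ≤ s₁ := zero_le_one.trans hs₁
  obtain ⟨a, ha, hap₀⟩ := exists_eqOn_powerSum hp₀ (hs₁0.trans hs₁₀.le) hs₀r
  have hp₀a : ∀ z ∈ Metric.ball (0 : ℂ) s, powerSum a z = p₀ z := fun z hz =>
    hap₀ (Metric.ball_subset_ball hsr.le hz)
  obtain ⟨b, hb, c, hconv, hclose, hsol⟩ := exists_coeff_solution hs₁ hs₁₀ ha hδ
  have hinit : c 0 = a := funext fun n => by simpa using hsol 0 ⟨le_rfl, hb.le⟩ n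
  refine ⟨b, hb, _, _, hsol.isReciprocalSolution hconv hs hss₁, fun z hz => ?_, fun t z hz => ?_⟩
  · simp only [hinit, hp₀a z hz]
  have hzs : ‖z‖ ≤ s₁ := (mem_ball_zero_iff.1 hz).le.trans hss₁.le
  have ha' : Summable fun n => ‖a n‖ * s₁ ^ n := hinit ▸ hconv.summable hs₁0 0
  have hdiff : Summable fun n => ‖c t n - a n‖ * s₁ ^ n :=
    .of_nonneg_of_le (fun _ => by positivity)
      (fun n => by rw [← add_mul]; gcongr; exact norm_sub_le _ _)
      ((hconv.summable hs₁0 t).add ha')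
  rw [← hp₀a z hz, powerSum_sub (summable_norm_mul_pow (hconv.summable hs₁0 t) hzs).of_norm
    (summable_norm_mul_pow ha' hzs).of_norm]
  exact (norm_powerSum_le hdiff hzs).trans (hclose t)

end ReciprocalSolution

section TimeDerivative

theorem tendstoUniformlyOn_slope {X F : Type*} [NormedAddCommGroup F] [NormedSpace ℝ F]
    {f g : ℝ → X → F} {I : Set ℝ} {K : Set X} {t : ℝ} (hI : Convex ℝ I) (ht : t ∈ I)
    (hf : ∀ x ∈ K, ∀ τ ∈ I, HasDerivWithinAt (fun τ => f τ x) (g τ x) I τ)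
    (hg : TendstoUniformlyOn g (g t) (𝓝[I] t) K) :
    TendstoUniformlyOn (fun τ x => (τ - t)⁻¹ • (f τ x - f t x)) (g t) (𝓝[I \ {t}] t) K := by
  rw [Metric.tendstoUniformlyOn_iff] at hg ⊢
  intro ε hε
  obtain ⟨η, hη, hgη⟩ := Metric.mem_nhdsWithin_iff.1 (hg (ε / 2) (half_pos hε))
  filter_upwards [inter_mem_nhdsWithin (I \ {t}) (Metric.ball_mem_nhds t hη)] with τ hτ x hx
  have hmean : ‖(f τ x - τ • g t x) - (f t x - t • g t x)‖ ≤ ε / 2 * ‖τ - t‖ := by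
    refine ((convex_ball t η).inter hI).norm_image_sub_le_of_norm_hasDerivWithin_le
      (f := fun σ => f σ x - σ • g t x) (f' := fun σ => g σ x - g t x) (fun σ hσ => ?_)
      (fun σ hσ => ?_) ⟨Metric.mem_ball_self hη, ht⟩ ⟨hτ.2, hτ.1.1⟩
    · have hlinear := ((hasDerivAt_id σ).smul_const (g t x)).hasDerivWithinAt
        (s := Metric.ball t η ∩ I)
      rw [one_smul] at hlinear
      exact ((hf x hx σ hσ.2).mono inter_subset_right).sub hlinear
    · rw [← dist_eq_norm, dist_comm]
      exact (hgη hσ x hx).le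
  have hne : τ - t ≠ 0 := sub_ne_zero.2 hτ.1.2
  have herror : (τ - t)⁻¹ • (f τ x - f t x) - g t x =
      (τ - t)⁻¹ • ((f τ x - τ • g t x) - (f t x - t • g t x)) := by
    rw [sub_sub_sub_comm, ← sub_smul, smul_sub _ (f τ x - f t x), inv_smul_smul₀ hne]
  rw [dist_comm, dist_eq_norm, herror, norm_smul, norm_inv, inv_mul_lt_iff₀ (norm_pos_iff.2 hne)]
  exact hmean.trans_lt (by nlinarith [norm_pos_iff.2 hne])

theorem IsC1.mono {b T : ℝ} {E : Set ℂ} {f : ℝ → ℂ → ℂ} (hf : IsC1 b E f) (hT : T ≤ b) :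
    IsC1 T E f := by
  obtain ⟨U, hU, hEU, g, hg⟩ := hf
  have hsub : Icc 0 T ⊆ Icc 0 b := Icc_subset_Icc_right hT
  refine ⟨U, hU, hEU, g, fun t ht => ?_⟩
  obtain ⟨hft, hgt, hslope, hcont⟩ := hg t (hsub ht)
  exact ⟨hft, hgt,
    fun u hu => nhdsWithin_mono t (sdiff_subset_sdiff_left hsub) (hslope u hu),
    fun u hu => nhdsWithin_mono t hsub (hcont u hu)⟩

theorem isC1_of_hasDerivWithinAt {b : ℝ} {E U : Set ℂ} {f g : ℝ → ℂ → ℂ} (hE : IsCompact E)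
    (hU : IsOpen U) (hEU : E ⊆ U) (hf : ∀ t ∈ Icc 0 b, AnalyticOnNhd ℂ (f t) U)
    (hg : ∀ t ∈ Icc 0 b, AnalyticOnNhd ℂ (g t) U)
    (hderiv : ∀ z ∈ U, ∀ t ∈ Icc 0 b, HasDerivWithinAt (fun τ => f τ z) (g t z) (Icc 0 b) t)
    (hcont : ContinuousOn (fun q : ℝ × ℂ => g q.1 q.2) (Icc 0 b ×ˢ U)) : IsC1 b E f := by
  obtain ⟨V, hV, hEV, hVU, hK⟩ := exists_open_between_and_isCompact_closure hE hU hEU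
  have hVU' : V ⊆ U := subset_closure.trans hVU
  refine ⟨V, hV, hEV, g, fun t ht => ?_⟩
  have hunif : TendstoUniformlyOn g (g t) (𝓝[Icc 0 b] t) V := by
    intro u hu
    obtain ⟨v, hv, hvu⟩ := hK.mem_uniformity_of_prod
      (hcont.mono (prod_mono subset_rfl hVU)) ht (symm_le_uniformity hu)
    filter_upwards [hv] with τ hτ z hz using hvu τ hτ z (subset_closure hz)
  refine ⟨(hf t ht).mono hVU', (hg t ht).mono hVU', ?_, hunif⟩
  refine (tendstoUniformlyOn_slope (convex_Icc 0 b) ht (fun z hz => hderiv z (hVU' hz))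
    hunif).congr (.of_forall fun τ z _ => ?_)
  simp only [Complex.real_smul, Complex.ofReal_inv, inv_mul_eq_div]

end TimeDerivative

theorem hasDerivAt_intervalIntegral_of_continuousOn {𝕜 E : Type*} [RCLike 𝕜]
    [NormedAddCommGroup E] [NormedSpace ℝ E] [NormedSpace 𝕜 E] {a b : ℝ} {F F' : ℝ → 𝕜 → E}
    {U : Set 𝕜} {x : 𝕜} (hU : IsOpen U) (hx : x ∈ U)
    (hF : ContinuousOn (fun q : ℝ × 𝕜 => F q.1 q.2) (uIcc a b ×ˢ U))
    (hF' : ContinuousOn (fun q : ℝ × 𝕜 => F' q.1 q.2) (uIcc a b ×ˢ U))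
    (hderiv : ∀ t ∈ uIcc a b, ∀ y ∈ U, HasDerivAt (F t) (F' t y) y) :
    HasDerivAt (fun y => ∫ t in a..b, F t y) (∫ t in a..b, F' t x) x := by
  obtain ⟨K, hKx, hKU, hK⟩ := local_compact_nhds (hU.mem_nhds hx)
  obtain ⟨C, hC⟩ := (isCompact_uIcc.prod hK).exists_bound_of_continuousOn
    (hF'.mono (prod_mono subset_rfl hKU))
  have hIoc : uIoc a b ⊆ uIcc a b := uIoc_subset_uIcc
  have hmeas : ∀ {y}, ∀ G : ℝ → 𝕜 → E, ContinuousOn (fun q : ℝ × 𝕜 => G q.1 q.2)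
      (uIcc a b ×ˢ U) → y ∈ U → IntervalIntegrable (fun t => G t y) MeasureTheory.volume a b :=
    fun G hG hy => (hG.uncurry_right _ hy).intervalIntegrable
  exact (intervalIntegral.hasDerivAt_integral_of_dominated_loc_of_deriv_le
    (F := fun y t => F t y) (F' := fun y t => F' t y) (bound := fun _ => C) hKx
    (by filter_upwards [hU.mem_nhds hx] with y hy using
      (hmeas F hF hy).aestronglyMeasurable_restrict_uIoc)
    (hmeas F hF hx) (hmeas F' hF' hx).aestronglyMeasurable_restrict_uIoc
    (.of_forall fun t ht y hy => hC (t, y) ⟨hIoc ht, hy⟩) intervalIntegrable_const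
    (.of_forall fun t ht y hy => hderiv t (hIoc ht) y (hKU hy))).2

theorem eq_mul_exp_neg_integral {u k : ℝ → ℂ} {b t : ℝ} (hk : Continuous k)
    (hu : ∀ t ∈ Icc 0 b, HasDerivWithinAt u (-(k t * u t)) (Icc 0 b) t) (ht : t ∈ Icc 0 b) :
    u t = u 0 * Complex.exp (-∫ τ in (0 : ℝ)..t, k τ) := by
  have hexp : ∀ t, HasDerivAt (fun t => Complex.exp (∫ τ in (0 : ℝ)..t, k τ))
      (Complex.exp (∫ τ in (0 : ℝ)..t, k τ) * k t) t := fun t =>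
    (hk.integral_hasStrictDerivAt 0 t).hasDerivAt.cexp
  have hprod : ∀ t ∈ Icc 0 b, HasDerivWithinAt
      (fun t => u t * Complex.exp (∫ τ in (0 : ℝ)..t, k τ)) 0 (Icc 0 b) t := fun t ht =>
    ((hu t ht).mul (hexp t).hasDerivWithinAt).congr_deriv (by ring)
  have hconst := constant_of_derivWithin_zero
    (fun t ht => (hprod t ht).differentiableWithinAt)
    (fun t ht => (hprod t ⟨ht.1, ht.2.le⟩).derivWithin
      (uniqueDiffOn_Icc (ht.1.trans_lt ht.2) t ⟨ht.1, ht.2.le⟩)) t ht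
  simp only [intervalIntegral.integral_same, Complex.exp_zero, mul_one] at hconst
  rw [← hconst, mul_assoc, ← Complex.exp_add, add_neg_cancel, Complex.exp_zero, mul_one]

theorem exists_forall_norm_inv_sub_inv_lt {m η : ℝ} (hm : 0 < m) (hη : 0 < η) :
    ∃ δ > 0, ∀ w w₀ : ℂ, m ≤ ‖w₀‖ → ‖w - w₀‖ ≤ δ → w ≠ 0 ∧ ‖w⁻¹ - w₀⁻¹‖ < η := by
  have hunif : UniformContinuousOn (Inv.inv : ℂ → ℂ) (Metric.ball 0 (m / 2))ᶜ :=
    uniformContinuousOn_inv₀ (by simpa using Metric.ball_mem_nhds (0 : ℂ) (half_pos hm))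
  obtain ⟨δ, hδ, hinv⟩ := Metric.uniformContinuousOn_iff.1 hunif η hη
  refine ⟨min (m / 2) (δ / 2), by positivity, fun w w₀ hw₀ hw => ?_⟩
  have hfar : ∀ v : ℂ, m / 2 ≤ ‖v‖ → v ∈ (Metric.ball (0 : ℂ) (m / 2))ᶜ := fun v hv => by
    simpa using hv
  have hlower : m / 2 ≤ ‖w‖ := by
    have htriangle := norm_sub_norm_le w₀ w
    rw [norm_sub_rev] at htriangle
    linarith [min_le_left (m / 2) (δ / 2)]
  have hdist : dist w w₀ < δ := by
    rw [dist_eq_norm]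
    linarith [min_le_right (m / 2) (δ / 2)]
  refine ⟨norm_pos_iff.1 ((half_pos hm).trans_le hlower), ?_⟩
  rw [← dist_eq_norm]
  exact hinv w (hfar w hlower) w₀ (hfar w₀ (by linarith)) hdist

section Evolution

/-- The time derivative `z h / p` of the mapping function. -/
noncomputable def velocity (h p : ℂ → ℂ) (z : ℂ) : ℂ := z * h z / p z

/-- The mapping function obtained from the initial value `f₀` by integrating the velocity
`z h / p` in time. -/
noncomputable def evolution (f₀ : ℂ → ℂ) (h p : ℝ → ℂ → ℂ) (t : ℝ) (z : ℂ) : ℂ :=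
  f₀ z + ∫ τ in (0 : ℝ)..t, velocity (h τ) (p τ) z

theorem evolution_zero (f₀ : ℂ → ℂ) (h p : ℝ → ℂ → ℂ) : evolution f₀ h p 0 = f₀ := by
  ext z
  rw [evolution, intervalIntegral.integral_same, add_zero]

theorem hasDerivAt_velocity {h p : ℂ → ℂ} {z : ℂ} (hh : DifferentiableAt ℂ h z)
    (hp : DifferentiableAt ℂ p z) (hpz : p z ≠ 0) :
    HasDerivAt (velocity h p) (-transportField h p z / p z ^ 2) z := by
  refine (((hasDerivAt_id z).mul hh.hasDerivAt).div hp.hasDerivAt hpz).congr_deriv ?_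
  simp only [transportField, id, Pi.mul_apply]
  ring

theorem re_velocity_mul_conj {h p : ℂ → ℂ} {ξ : ℂ} (hξ : ‖ξ‖ = 1) (hp : p ξ ≠ 0)
    (hre : (h ξ).re = ‖p ξ‖ ^ 2) :
    (velocity h p ξ * (starRingEnd ℂ) ((p ξ)⁻¹ * ξ)).re = 1 := by
  have hξ' : ξ * (starRingEnd ℂ) ξ = 1 := by rw [Complex.mul_conj', hξ]; norm_num
  have hvel : velocity h p ξ * (starRingEnd ℂ) ((p ξ)⁻¹ * ξ) = h ξ * ((‖p ξ‖ ^ 2 : ℝ) : ℂ)⁻¹ := by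
    rw [Complex.ofReal_pow, ← Complex.mul_conj', velocity, map_mul, map_inv₀, mul_inv,
      div_eq_mul_inv]
    linear_combination (h ξ * (p ξ)⁻¹ * ((starRingEnd ℂ) (p ξ))⁻¹) * hξ'
  rw [hvel, ← Complex.ofReal_inv, Complex.re_mul_ofReal, hre]
  exact mul_inv_cancel₀ (by positivity)

namespace IsReciprocalSolution

variable {b s t : ℝ} {f₀ : ℂ → ℂ} {p h : ℝ → ℂ → ℂ} {z : ℂ}

theorem continuousOn_velocity (H : IsReciprocalSolution b s p h)
    (hp : ∀ t, ∀ z ∈ Metric.ball 0 s, p t z ≠ 0) :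
    ContinuousOn (fun q : ℝ × ℂ => velocity (h q.1) (p q.1) q.2) (univ ×ˢ Metric.ball 0 s) :=
  (continuousOn_snd.mul H.continuousOn_h).div H.continuousOn_p fun q hq => hp q.1 q.2 hq.2

theorem hasDerivAt_velocity (H : IsReciprocalSolution b s p h)
    (hp : ∀ t, ∀ z ∈ Metric.ball 0 s, p t z ≠ 0) (t : ℝ) (hz : z ∈ Metric.ball 0 s) :
    HasDerivAt (velocity (h t) (p t)) (-transportField (h t) (p t) z / p t z ^ 2) z :=
  have hnhds := Metric.isOpen_ball.mem_nhds hz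
  HeleShaw.hasDerivAt_velocity ((H.differentiableOn_h t).differentiableAt hnhds)
    ((H.differentiableOn_p t).differentiableAt hnhds) (hp t z hz)

theorem hasDerivAt_evolution_time (H : IsReciprocalSolution b s p h)
    (hp : ∀ t, ∀ z ∈ Metric.ball 0 s, p t z ≠ 0) (f₀ : ℂ → ℂ) (t : ℝ)
    (hz : z ∈ Metric.ball 0 s) :
    HasDerivAt (fun τ => evolution f₀ h p τ z) (velocity (h t) (p t) z) t :=
  have hcont := continuousOn_univ.1 ((H.continuousOn_velocity hp).uncurry_right z hz)
  (hcont.integral_hasStrictDerivAt 0 t).hasDerivAt.const_add _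

theorem integral_neg_transportField_div_sq (H : IsReciprocalSolution b s p h)
    (hp : ∀ t, ∀ z ∈ Metric.ball 0 s, p t z ≠ 0) (ht : t ∈ Icc 0 b) (hz : z ∈ Metric.ball 0 s) :
    ∫ τ in (0 : ℝ)..t, -transportField (h τ) (p τ) z / p τ z ^ 2 = (p t z)⁻¹ - (p 0 z)⁻¹ := by
  have hpcont : Continuous fun τ => p τ z :=
    continuousOn_univ.1 (H.continuousOn_p.uncurry_right z hz)
  have hfield : Continuous fun τ => transportField (h τ) (p τ) z :=
    continuousOn_univ.1 (H.continuousOn_transportField.uncurry_right z hz)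
  refine intervalIntegral.integral_eq_sub_of_hasDerivAt_of_le (f := fun τ => (p τ z)⁻¹) ht.1
    (hpcont.inv₀ fun τ => hp τ z hz).continuousOn (fun τ hτ => ?_)
    ((hfield.neg.div (hpcont.pow 2) fun τ => pow_ne_zero 2 (hp τ z hz)).intervalIntegrable _ _)
  have hτb : τ < b := hτ.2.trans_le ht.2
  exact ((H.hasDerivWithinAt z hz τ ⟨hτ.1.le, hτb.le⟩).hasDerivAt
    (Icc_mem_nhds hτ.1 hτb)).inv (hp τ z hz)

theorem hasDerivAt_evolution (H : IsReciprocalSolution b s p h)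
    (hp : ∀ t, ∀ z ∈ Metric.ball 0 s, p t z ≠ 0) (ht : t ∈ Icc 0 b) (hz : z ∈ Metric.ball 0 s)
    (hf₀ : HasDerivAt f₀ (p 0 z)⁻¹ z) : HasDerivAt (evolution f₀ h p t) (p t z)⁻¹ z := by
  have hsub : uIcc 0 t ×ˢ Metric.ball (0 : ℂ) s ⊆ univ ×ˢ Metric.ball 0 s :=
    prod_mono (subset_univ _) subset_rfl
  have hcont : ContinuousOn (fun q : ℝ × ℂ => -transportField (h q.1) (p q.1) q.2 / p q.1 q.2 ^ 2)
      (univ ×ˢ Metric.ball 0 s) :=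
    H.continuousOn_transportField.neg.div (H.continuousOn_p.pow 2)
      fun q hq => pow_ne_zero 2 (hp q.1 q.2 hq.2)
  have hintegral := hasDerivAt_intervalIntegral_of_continuousOn
    (F := fun τ z => velocity (h τ) (p τ) z) Metric.isOpen_ball hz
    ((H.continuousOn_velocity hp).mono hsub) (hcont.mono hsub)
    fun τ _ w hw => H.hasDerivAt_velocity hp τ hw
  rw [H.integral_neg_transportField_div_sq hp ht hz] at hintegral
  exact (hf₀.add hintegral).congr_deriv (add_sub_cancel _ _)

theorem analyticOnNhd_evolution (H : IsReciprocalSolution b s p h)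
    (hp : ∀ t, ∀ z ∈ Metric.ball 0 s, p t z ≠ 0)
    (hf₀ : ∀ z ∈ Metric.ball 0 s, HasDerivAt f₀ (p 0 z)⁻¹ z) (ht : t ∈ Icc 0 b) :
    AnalyticOnNhd ℂ (evolution f₀ h p t) (Metric.ball 0 s) :=
  DifferentiableOn.analyticOnNhd (fun z hz =>
    (H.hasDerivAt_evolution hp ht hz (hf₀ z hz)).differentiableAt.differentiableWithinAt)
    Metric.isOpen_ball

theorem isC1_evolution {E : Set ℂ} (H : IsReciprocalSolution b s p h)
    (hp : ∀ t, ∀ z ∈ Metric.ball 0 s, p t z ≠ 0)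
    (hf₀ : ∀ z ∈ Metric.ball 0 s, HasDerivAt f₀ (p 0 z)⁻¹ z) (hE : IsCompact E)
    (hEs : E ⊆ Metric.ball 0 s) : IsC1 b E (evolution f₀ h p) :=
  isC1_of_hasDerivWithinAt (g := fun t => velocity (h t) (p t)) hE Metric.isOpen_ball hEs
    (fun _ => H.analyticOnNhd_evolution hp hf₀)
    (fun t _ => DifferentiableOn.analyticOnNhd (fun _ hz =>
      (H.hasDerivAt_velocity hp t hz).differentiableAt.differentiableWithinAt) Metric.isOpen_ball)
    (fun _ hz t _ => (H.hasDerivAt_evolution_time hp f₀ t hz).hasDerivWithinAt)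
    ((H.continuousOn_velocity hp).mono (prod_mono (subset_univ _) subset_rfl))

theorem apply_zero_eq (H : IsReciprocalSolution b s p h) (hs : 0 < s) (ht : t ∈ Icc 0 b) :
    p t 0 = p 0 0 * (Real.exp (-∫ τ in (0 : ℝ)..t, (h τ 0).re) : ℝ) := by
  have h0 : (0 : ℂ) ∈ Metric.ball (0 : ℂ) s := Metric.mem_ball_self hs
  have hreal : ∀ τ, ((h τ 0).re : ℂ) = h τ 0 := fun τ => by
    rw [Complex.ext_iff]
    exact ⟨rfl, (H.im_h_zero τ).symm⟩
  have hode : ∀ t ∈ Icc 0 b, HasDerivWithinAt (fun τ => p τ 0) (-(h t 0 * p t 0)) (Icc 0 b) t :=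
    fun t ht => (H.hasDerivWithinAt 0 h0 t ht).congr_deriv (by simp [transportField])
  rw [eq_mul_exp_neg_integral (continuousOn_univ.1 (H.continuousOn_h.uncurry_right 0 h0)) hode ht]
  push_cast [← intervalIntegral.integral_ofReal]
  simp only [hreal]

theorem normalized_evolution (H : IsReciprocalSolution b s p h)
    (hp : ∀ t, ∀ z ∈ Metric.ball 0 s, p t z ≠ 0)
    (hf₀ : ∀ z ∈ Metric.ball 0 s, HasDerivAt f₀ (p 0 z)⁻¹ z) (hn : Normalized f₀) (hs : 0 < s)
    (ht : t ∈ Icc 0 b) : Normalized (evolution f₀ h p t) := by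
  have h0 : (0 : ℂ) ∈ Metric.ball (0 : ℂ) s := Metric.mem_ball_self hs
  have hderiv : deriv (evolution f₀ h p t) 0 =
      deriv f₀ 0 * (Real.exp (∫ τ in (0 : ℝ)..t, (h τ 0).re) : ℝ) := by
    rw [(H.hasDerivAt_evolution hp ht h0 (hf₀ 0 h0)).deriv, (hf₀ 0 h0).deriv,
      H.apply_zero_eq hs ht, mul_inv, ← Complex.ofReal_inv, Real.exp_neg, inv_inv]
  obtain ⟨hzero, him, hre⟩ := hn
  refine ⟨by simp [evolution, velocity, hzero], ?_, ?_⟩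
  · rw [hderiv, Complex.im_mul_ofReal, him, zero_mul]
  · rw [hderiv, Complex.re_mul_ofReal]
    exact mul_pos hre (Real.exp_pos _)

theorem re_derivWithin_evolution_mul_conj (H : IsReciprocalSolution b s p h)
    (hp : ∀ t, ∀ z ∈ Metric.ball 0 s, p t z ≠ 0)
    (hf₀ : ∀ z ∈ Metric.ball 0 s, HasDerivAt f₀ (p 0 z)⁻¹ z) (hb : 0 < b) (hs : 1 < s)
    (ht : t ∈ Icc 0 b) (hz : ‖z‖ = 1) :
    (derivWithin (fun τ => evolution f₀ h p τ z) (Icc 0 b) t *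
      (starRingEnd ℂ) (deriv (evolution f₀ h p t) z * z)).re = 1 := by
  have hzs : z ∈ Metric.ball 0 s := mem_ball_zero_iff.2 (hz.trans_lt hs)
  rw [(H.hasDerivAt_evolution_time hp f₀ t hzs).hasDerivWithinAt.derivWithin
    (uniqueDiffOn_Icc hb t ht), (H.hasDerivAt_evolution hp ht hzs (hf₀ z hzs)).deriv]
  exact re_velocity_mul_conj hz (hp t z hzs) (H.re_h t z hz)

end IsReciprocalSolution

end Evolution

section StrongSolution

variable {f₀ : ℂ → ℂ} {r s : ℝ}

theorem exists_reciprocal_solution_near_deriv {η : ℝ}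
    (hf₀ : AnalyticOnNhd ℂ f₀ (Metric.ball 0 r)) (hderiv : ∀ z ∈ Metric.ball 0 r, deriv f₀ z ≠ 0)
    (hs : 1 ≤ s) (hsr : s < r) (hη : 0 < η) :
    ∃ b > 0, ∃ p h : ℝ → ℂ → ℂ, IsReciprocalSolution b s p h ∧
      (∀ z ∈ Metric.ball 0 s, (p 0 z)⁻¹ = deriv f₀ z) ∧
      ∀ t, ∀ z ∈ Metric.ball 0 s, p t z ≠ 0 ∧ ‖(p t z)⁻¹ - deriv f₀ z‖ < η := by
  have hp₀ : DifferentiableOn ℂ (fun z => (deriv f₀ z)⁻¹) (Metric.ball 0 r) :=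
    hf₀.deriv.differentiableOn.inv hderiv
  have hsub : Metric.closedBall (0 : ℂ) s ⊆ Metric.ball 0 r := Metric.closedBall_subset_ball hsr
  obtain ⟨m, hm, hmp₀⟩ := (isCompact_closedBall (0 : ℂ) s).exists_forall_le'
    (hp₀.continuousOn.mono hsub).norm fun z hz => norm_pos_iff.2 (inv_ne_zero (hderiv z (hsub hz)))
  obtain ⟨δ, hδ, hinv⟩ := exists_forall_norm_inv_sub_inv_lt hm hη
  obtain ⟨b, hb, p, h, H, hp0, hpδ⟩ := exists_reciprocal_solution hp₀ hs hsr hδ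
  refine ⟨b, hb, p, h, H, fun z hz => by rw [hp0 hz, inv_inv], fun t z hz => ?_⟩
  simpa only [inv_inv] using
    hinv _ _ (hmp₀ z (Metric.ball_subset_closedBall hz)) (hpδ t z hz)

theorem exists_evolution_injOn (hf₀ : AnalyticOnNhd ℂ f₀ (Metric.ball 0 r))
    (hinj : InjOn f₀ (Metric.ball 0 r)) (hs : 1 ≤ s) (hsr : s < r) :
    ∃ b > 0, ∃ p h : ℝ → ℂ → ℂ, IsReciprocalSolution b s p h ∧
      (∀ t, ∀ z ∈ Metric.ball 0 s, p t z ≠ 0) ∧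
      (∀ z ∈ Metric.ball 0 s, HasDerivAt f₀ (p 0 z)⁻¹ z) ∧
      ∀ t ∈ Icc 0 b, InjOn (evolution f₀ h p t) (Metric.ball 0 s) := by
  have hderiv : ∀ z ∈ Metric.ball (0 : ℂ) r, deriv f₀ z ≠ 0 := fun z hz =>
    deriv_ne_zero_of_injOn (hf₀ z hz) (Metric.isOpen_ball.mem_nhds hz) hinj
  obtain ⟨c, hc, hrevLip⟩ := exists_mul_norm_sub_le_of_injOn Metric.isOpen_ball hf₀ hinj
    (isCompact_closedBall (0 : ℂ) s) (Metric.closedBall_subset_ball hsr)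
  obtain ⟨b, hb, p, h, H, hp0, hclose⟩ :=
    exists_reciprocal_solution_near_deriv hf₀ hderiv hs hsr (half_pos hc)
  have hf₀' : ∀ z ∈ Metric.ball (0 : ℂ) s, HasDerivAt f₀ (deriv f₀ z) z := fun z hz =>
    (hf₀ z (Metric.ball_subset_ball hsr.le hz)).differentiableAt.hasDerivAt
  have hf₀p : ∀ z ∈ Metric.ball (0 : ℂ) s, HasDerivAt f₀ (p 0 z)⁻¹ z := fun z hz =>
    hp0 z hz ▸ hf₀' z hz
  have hp : ∀ t, ∀ z ∈ Metric.ball (0 : ℂ) s, p t z ≠ 0 := fun t z hz => (hclose t z hz).1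
  have hball : Metric.ball (0 : ℂ) s ⊆ Metric.closedBall 0 s := Metric.ball_subset_closedBall
  exact ⟨b, hb, p, h, H, hp, hf₀p, fun t ht => injOn_of_norm_deriv_sub_le (convex_ball 0 s)
    (fun z hz w hw => hrevLip z (hball hz) w (hball hw)) hf₀'
    (fun z hz => H.hasDerivAt_evolution hp ht hz (hf₀p z hz))
    (fun z hz => (hclose t z hz).2.le) (half_lt_self hc)⟩

theorem O_anti {E E' : Set ℂ} (h : E ⊆ E') : O E' ⊆ O E := fun _ hf =>
  ⟨hf.1.imp fun _ hU => ⟨hU.1, h.trans hU.2.1, hU.2.2⟩, hf.2⟩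

theorem exists_ball_of_mem_O (hf₀ : f₀ ∈ O (closedDisk s)) (hs : 0 ≤ s) :
    ∃ r > s, AnalyticOnNhd ℂ f₀ (Metric.ball 0 r) ∧ InjOn f₀ (Metric.ball 0 r) := by
  obtain ⟨⟨U, hU, hEU, hfU, hinj⟩, -⟩ := hf₀
  obtain ⟨δ, hδ, hδU⟩ := (isCompact_closedBall (0 : ℂ) s).exists_thickening_subset_open hU hEU
  rw [thickening_closedBall hδ hs] at hδU
  exact ⟨δ + s, lt_add_of_pos_left s hδ, hfU.mono hδU, hinj.mono hδU⟩

theorem IsStrongSolution.Ico_of_Icc {b : ℝ} {f : ℝ → ℂ → ℂ}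
    (hf : IsStrongSolution (Icc 0 b) f) : IsStrongSolution (Ico 0 b) f where
  univalent t ht := hf.univalent t (Ico_subset_Icc_self ht)
  contDiff T hT := hf.contDiff T (Ico_subset_Icc_self hT)
  equation t ht ξ hξ := by
    have hnhds : Ico 0 b =ᶠ[𝓝 t] Icc 0 b := by
      filter_upwards [Iio_mem_nhds ht.2] with τ hτ
      exact propext ⟨fun h => Ico_subset_Icc_self h, fun h => ⟨h.1, hτ⟩⟩
    rw [derivWithin_congr_set hnhds]
    exact hf.equation t (Ico_subset_Icc_self ht) ξ hξ

end StrongSolution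

end HeleShaw

open HeleShaw in
theorem mainTheorem7_general {f₀ : ℂ → ℂ} {r s : ℝ} (hs : 1 < s) (hsr : s < r)
    (hf₀ : AnalyticOnNhd ℂ f₀ (Metric.ball 0 r)) (hinj : Set.InjOn f₀ (Metric.ball 0 r))
    (hn : Normalized f₀) :
    ∃ b > 0, ∃ f : ℝ → ℂ → ℂ, f 0 = f₀ ∧ IsStrongSolution (Set.Icc 0 b) f ∧
      IsC1 b (closedDisk s) f ∧ ∀ t ∈ Set.Icc 0 b, f t ∈ O (closedDisk s) := by
  obtain ⟨s', hss', hs'r⟩ := exists_between hsr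
  have hs' : 1 < s' := hs.trans hss'
  obtain ⟨b, hb, p, h, H, hp, hf₀p, hinj_t⟩ := exists_evolution_injOn hf₀ hinj hs'.le hs'r
  have hO : ∀ t ∈ Set.Icc 0 b, evolution f₀ h p t ∈ O (closedDisk s) := fun t ht =>
    ⟨⟨_, Metric.isOpen_ball, Metric.closedBall_subset_ball hss',
      H.analyticOnNhd_evolution hp hf₀p ht, hinj_t t ht⟩,
      H.normalized_evolution hp hf₀p hn (zero_lt_one.trans hs') ht⟩
  have hC1 : ∀ x < s', IsC1 b (closedDisk x) (evolution f₀ h p) := fun x hx =>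
    H.isC1_evolution hp hf₀p (isCompact_closedBall 0 x) (Metric.closedBall_subset_ball hx)
  refine ⟨b, hb, evolution f₀ h p, evolution_zero f₀ h p, ?_, hC1 s hss', hO⟩
  exact
    { univalent := fun t ht => O_anti (Metric.closedBall_subset_closedBall hs.le) (hO t ht)
      contDiff := fun T hT => (hC1 1 hs').mono hT.2
      equation := fun t ht ξ => H.re_derivWithin_evolution_mul_conj hp hf₀p hb hs' ht }

theorem mainTheorem7 :
    (∀ (f₀ : ℂ → ℂ) (r ρ₀ : ℝ), 1 < r → r < ρ₀ →
      f₀ ∈ HeleShaw.H (HeleShaw.closedDisk ρ₀) →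
      Set.InjOn f₀ (HeleShaw.closedDisk r) →
      HeleShaw.Normalized f₀ →
      ∀ r' : ℝ, 1 < r' → r' < r →
        ∃ b : ℝ, 0 < b ∧ ∃ f : ℝ → ℂ → ℂ,
          Set.EqOn (f 0) f₀ (HeleShaw.closedDisk r') ∧
          HeleShaw.IsStrongSolution (Set.Icc 0 b) f ∧
          HeleShaw.IsC1 b (HeleShaw.closedDisk r') f ∧
          ∀ t ∈ Set.Icc 0 b, f t ∈ HeleShaw.O (HeleShaw.closedDisk r')) ∧
    (∀ f₀ ∈ HeleShaw.O (HeleShaw.closedDisk 1),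
      ∃ b : ℝ, 0 < b ∧ ∃ f : ℝ → ℂ → ℂ,
        Set.EqOn (f 0) f₀ (HeleShaw.closedDisk 1) ∧
        HeleShaw.IsStrongSolution (Set.Ico 0 b) f) := by
  constructor
  · intro f₀ r ρ₀ _ hr hf₀ hinj hn r' hr' hr'r
    have hball : Metric.ball 0 r ⊆ HeleShaw.closedDisk r := Metric.ball_subset_closedBall
    obtain ⟨b, hb, f, rfl, hf⟩ := mainTheorem7_general hr' hr'r
      (hf₀.mono (hball.trans (Metric.closedBall_subset_closedBall hr.le))) (hinj.mono hball) hn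
    exact ⟨b, hb, f, Set.eqOn_refl _ _, hf⟩
  · intro f₀ hf₀
    obtain ⟨r, hr, hf₀r, hinj⟩ := HeleShaw.exists_ball_of_mem_O hf₀ zero_le_one
    obtain ⟨s, hs, hsr⟩ := exists_between hr
    obtain ⟨b, hb, f, rfl, hf, -⟩ := mainTheorem7_general hs hsr hf₀r hinj hf₀.2
    exact ⟨b, hb, f, Set.eqOn_refl _ _, hf.Ico_of_Icc⟩
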